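/- Let $K$ be an algebraically closed field, $n\ge 0$, and let $\mathbf q=(q_{ij})\in M_n(K^*)$ be multiplicatively antisymmetric, i.e. $q_{ii}=1$ and $q_{ji}=q_{ij}^{-1}$ for all $i,j$. Let $\mathcal O_{\mathbf q}(K^n)$ be the $K$-algebra generated by $x_1,\dots,x_n$ subject only to the relations $x_ix_j=q_{ij}x_jx_i$, and let the quantum torus $\mathbb A_{\mathbf q}$ be the $K$-algebra generated by $x_1^{\pm1},\dots,x_n^{\pm1}$ subject to the same relations. For $a\in K^*$ let $\mathbb A_a$ denote the quantum torus of rank $2$ with generators $x^{\pm1},y^{\pm1}$ and relation $xy=a\,yx$. Suppose that the subgroup $\Lambda$ of $K^*$ generated by all $q_{ij}$ is torsion, and let $m=|\Lambda|$. Then $\Lambda$ is cyclic. For every generator $q$ of $\Lambda$ the quantum torus has a normal form with respect to $q$: there are an integer $s\ge 0$ with $2s\le n$ and positive divisors $1=h_1\mid h_2\mid\cdots\mid h_s$ of $m$, all smaller than $m$ (so $s=0$ if $m=1$), such that $$\mathbb A_{\mathbf q}\;\cong\;\mathbb A_{q^{e_1}}\otimes_K\cdots\otimes_K\mathbb A_{q^{e_s}}\otimes_K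 K[\mathbb Z^{n-2s}]$$ as $K$-algebras, where $e_i=h_i$ for all $i$, except that if $2s=n$ and $s\ge1$ then $e_s=zh_s$ for some $z\in\mathbb N$ with $\operatorname{ord}(q^{zh_s})=\operatorname{ord}(q^{h_s})$. Moreover, there is a surjective map $\Psi$ from $(K^*)^n$ onto the set of isomorphism classes of simple right $\mathcal O_{\mathbf q}(K^n)$-modules on which none of the variables $x_1,\dots,x_n$ acts as zero, such that, for every such normal form, with $k_i:=m/h_i$, $$\dim_K\Psi(\underline\alpha)=\prod_{i=1}^s k_i\qquad\text{for all }\underline\alpha\in(K^*)^n .$$ -/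

import Mathlib

open scoped TensorProduct

universe u

namespace QuantumSpace

/-- The defining relations `x i * x j = q i j * x j * x i` of quantum affine space. -/
inductive AffineRel {K : Type u} [Field K] {n : ℕ} (q : Matrix (Fin n) (Fin n) Kˣ) :
    FreeAlgebra K (Fin n) → FreeAlgebra K (Fin n) → Prop
  | comm (i j : Fin n) :
      AffineRel q (FreeAlgebra.ι K i * FreeAlgebra.ι K j)
        ((q i j : K) • (FreeAlgebra.ι K j * FreeAlgebra.ι K i))

/-- Multiparameter quantum affine `n`-space: the `K`-algebra generated by `x 1, …, x n`
subject only to the relations `x i * x j = q i j * x j * x i`. -/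
abbrev QAffine {K : Type u} [Field K] {n : ℕ} (q : Matrix (Fin n) (Fin n) Kˣ) : Type u :=
  RingQuot (AffineRel q)

/-- The generator `x i` of quantum affine space. -/
noncomputable def QAffine.x {K : Type u} [Field K] {n : ℕ} (q : Matrix (Fin n) (Fin n) Kˣ)
    (i : Fin n) : QAffine q :=
  RingQuot.mkAlgHom K (AffineRel q) (FreeAlgebra.ι K i)

/-- The defining relations of the quantum torus; the letter `Sum.inl i` stands for `x i`
and the letter `Sum.inr i` for its inverse. -/
inductive TorusRel {K : Type u} [Field K] {n : ℕ} (q : Matrix (Fin n) (Fin n) Kˣ) :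
    FreeAlgebra K (Fin n ⊕ Fin n) → FreeAlgebra K (Fin n ⊕ Fin n) → Prop
  | comm (i j : Fin n) :
      TorusRel q (FreeAlgebra.ι K (Sum.inl i) * FreeAlgebra.ι K (Sum.inl j))
        ((q i j : K) • (FreeAlgebra.ι K (Sum.inl j) * FreeAlgebra.ι K (Sum.inl i)))
  | mul_inv (i : Fin n) :
      TorusRel q (FreeAlgebra.ι K (Sum.inl i) * FreeAlgebra.ι K (Sum.inr i)) 1
  | inv_mul (i : Fin n) :
      TorusRel q (FreeAlgebra.ι K (Sum.inr i) * FreeAlgebra.ι K (Sum.inl i)) 1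

/-- The quantum torus of rank `n`: the `K`-algebra generated by `x 1, …, x n` and their
inverses subject only to the relations `x i * x j = q i j * x j * x i`. -/
abbrev QTorus {K : Type u} [Field K] {n : ℕ} (q : Matrix (Fin n) (Fin n) Kˣ) : Type u :=
  RingQuot (TorusRel q)

/-- The quantum torus of rank two with `x * y = a * y * x`. -/
abbrev QTorus₂ {K : Type u} [Field K] (a : Kˣ) : Type u :=
  QTorus (!![1, a; a⁻¹, 1] : Matrix (Fin 2) (Fin 2) Kˣ)

/-- `q` is multiplicatively antisymmetric. -/
def IsMulAntisymm {K : Type u} [Field K] {n : ℕ} (q : Matrix (Fin n) (Fin n) Kˣ) : Prop :=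
  (∀ i, q i i = 1) ∧ ∀ i j, q j i = (q i j)⁻¹

/-- The multiplicative group generated by the parameters `q i j`. -/
def paramGroup {K : Type u} [Field K] {n : ℕ} (q : Matrix (Fin n) (Fin n) Kˣ) : Subgroup Kˣ :=
  Subgroup.closure {a | ∃ i j, q i j = a}

/-- The exponents of the rank two factors in the normal form: these are `h 1, …, h s`, except
that in the case `2 * s = n` the last one is `z * h s`. -/
def normalExp (n : ℕ) {s : ℕ} (h : Fin s → ℕ) (z : ℕ) (i : Fin s) : ℕ :=
  if 2 * s = n ∧ i.val + 1 = s then z * h i else h i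

/-- `(s, h, z)` is a normal form of the quantum torus of `q` with respect to the generator `g`
of the parameter group. The nonzero classes modulo `m` of products of powers of the primes
dividing `m`, with exponents bounded by those in `m`, are represented by the divisors of `m`
smaller than `m`. -/
structure IsNormalForm {K : Type u} [Field K] {n : ℕ} (q : Matrix (Fin n) (Fin n) Kˣ)
    (g : Kˣ) (s : ℕ) (h : Fin s → ℕ) (z : ℕ) : Prop where
  two_mul_le : 2 * s ≤ n
  dvd_card : ∀ i, h i ∣ Nat.card (paramGroup q)
  lt_card : ∀ i, h i < Nat.card (paramGroup q)
  first : ∀ i : Fin s, i.val = 0 → h i = 1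
  chain : ∀ i j : Fin s, i ≤ j → h i ∣ h j
  order_eq : ∀ i : Fin s, orderOf (g ^ normalExp n h z i) = orderOf (g ^ h i)
  iso : Nonempty (QTorus q ≃ₐ[K]
    ((⨂[K] i : Fin s, QTorus₂ (g ^ normalExp n h z i)) ⊗[K]
      AddMonoidAlgebra K (Fin (n - 2 * s) → ℤ)))

/-- A simple right module over quantum affine space (a module over the opposite ring) on which
no variable acts as zero. -/
structure SimpleMod {K : Type u} [Field K] {n : ℕ} (q : Matrix (Fin n) (Fin n) Kˣ) where
  carrier : Type u
  [addCommGroup : AddCommGroup carrier]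
  [module : Module (QAffine q)ᵐᵒᵖ carrier]
  simple : IsSimpleModule (QAffine q)ᵐᵒᵖ carrier
  nontrivial : ∀ i : Fin n, ∃ v : carrier, MulOpposite.op (QAffine.x q i) • v ≠ 0

attribute [instance] SimpleMod.addCommGroup SimpleMod.module

/-- Isomorphism of modules, as an equivalence relation. -/
instance SimpleMod.setoid {K : Type u} [Field K] {n : ℕ} (q : Matrix (Fin n) (Fin n) Kˣ) :
    Setoid (SimpleMod q) where
  r M N := Nonempty (M.carrier ≃ₗ[(QAffine q)ᵐᵒᵖ] N.carrier)
  iseqv :=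
    { refl := fun _ => ⟨LinearEquiv.refl _ _⟩
      symm := fun ⟨e⟩ => ⟨e.symm⟩
      trans := fun ⟨e⟩ ⟨f⟩ => ⟨e.trans f⟩ }

/-- The dimension of a module over the ground field, which acts through the algebra. -/
noncomputable def SimpleMod.dim {K : Type u} [Field K] {n : ℕ}
    {q : Matrix (Fin n) (Fin n) Kˣ} (M : SimpleMod q) : Cardinal.{u} :=
  letI : Module K M.carrier := Module.compHom M.carrier (algebraMap K (QAffine q)ᵐᵒᵖ)
  Module.rank K M.carrier

theorem SimpleMod.dim_eq {K : Type u} [Field K] {n : ℕ}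
    {q : Matrix (Fin n) (Fin n) Kˣ} (M N : SimpleMod q) (hMN : M ≈ N) : M.dim = N.dim := by
  obtain ⟨e⟩ := hMN
  let _ : Module K M.carrier := Module.compHom M.carrier (algebraMap K (QAffine q)ᵐᵒᵖ)
  let _ : Module K N.carrier := Module.compHom N.carrier (algebraMap K (QAffine q)ᵐᵒᵖ)
  let f : M.carrier ≃ₗ[K] N.carrier :=
    { e.toAddEquiv with
      map_smul' := fun c v => e.map_smul (algebraMap K (QAffine q)ᵐᵒᵖ c) v }
  exact f.rank_eq

/-- The set of isomorphism classes of simple right modules on which no variable acts as zero. -/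
abbrev SimpleClass {K : Type u} [Field K] {n : ℕ} (q : Matrix (Fin n) (Fin n) Kˣ) : Type (u + 1) :=
  Quotient (SimpleMod.setoid q)

/-- The dimension over the ground field of an isomorphism class. -/
noncomputable def SimpleClass.dim {K : Type u} [Field K] {n : ℕ}
    {q : Matrix (Fin n) (Fin n) Kˣ} (c : SimpleClass q) : Cardinal.{u} :=
  Quotient.lift SimpleMod.dim SimpleMod.dim_eq c

end QuantumSpace

/-!
Write the parameters as `q i j = g ^ M i j` with `g` a generator of the cyclic group they generate
and `M` an alternating matrix modulo its order `m`. Replacing `x i` by `x i * x j ^ t` in a set of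
generators of the torus acts on `M` as a simultaneous row and column operation, and such
operations, pivoting on an entry with minimal gcd with `m`, bring `M` into the form of hyperbolic
blocks; the torus of such a matrix is the tensor product of the tori of its blocks.

On a simple module over quantum affine space a variable that does not act as zero is injective,
since its kernel is a submodule. The `m`-th powers of the variables are central, so the module is
finitely generated over a quotient of a polynomial ring, which is a field by Nakayama's lemma and
hence `K` by Zariski's lemma. So simple modules are finite dimensional, the variables act
invertibly on them, and they become modules over the block torus. There, with `k i` the order of
the parameter of the `i`-th pair `x i, y i`, the powers `x i ^ k i`, `y i ^ k i` and the
generators outside the blocks act by `n` scalars. As `x i` permutes the eigenvalues of `y i`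
transitively, every choice of `k i`-th roots is realised by a common eigenvector of the `y i`, and
the monomials in the `x i` applied to it span a submodule of dimension `∏ i, k i`. Applied to a
simple module this computes its dimension; applied to the sum of two simple modules with the same
scalars it produces the graph of an isomorphism. So the isomorphism classes inject into `(Kˣ)ⁿ`,
and `Ψ` is a left inverse of this injection; weighted shifts on the functions on `(ℤ/m)ⁿ` provide
a first class.
-/

namespace QuantumSpace

section SkewCommute

variable {K : Type*} [CommSemiring K] {A : Type*} [Semiring A] [Algebra K A]

/-- The units `u` and `v` of a `K`-algebra commute up to the scalar `c`. -/
def SkewCommute (c : Kˣ) (u v : Aˣ) : Prop :=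
  u * v = Units.map (algebraMap K A : K →* A) c * (v * u)

theorem units_map_algebraMap_commute (c : Kˣ) (u : Aˣ) :
    Commute (Units.map (algebraMap K A : K →* A) c) u :=
  Units.ext (Algebra.commutes _ _)

theorem skewCommute_iff {c : Kˣ} {u v : Aˣ} :
    SkewCommute c u v ↔ (u * v : A) = (c : K) • (v * u : A) := by
  rw [SkewCommute, Units.ext_iff, Algebra.smul_def]
  rfl

theorem skewCommute_one_iff {u v : Aˣ} : SkewCommute (1 : Kˣ) u v ↔ Commute u v := by
  simp [SkewCommute, Commute, SemiconjBy]

/-- The pairs `(c, u)` such that `u` commutes with `v` up to the scalar `c`; that they form a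
subgroup gives the rules for products and powers. -/
def skewCentralizer (v : Aˣ) : Subgroup (Kˣ × Aˣ) where
  carrier := {p | SkewCommute p.1 p.2 v}
  one_mem' := by simp [SkewCommute]
  mul_mem' := by
    rintro ⟨c, x⟩ ⟨d, y⟩ (h : SkewCommute c x v) (h' : SkewCommute d y v)
    change SkewCommute (c * d) (x * y) v
    unfold SkewCommute at *
    rw [mul_assoc, h', ← mul_assoc x, ← (units_map_algebraMap_commute d x).eq, mul_assoc,
      ← mul_assoc x, h, mul_comm c, map_mul]
    simp only [mul_assoc]
  inv_mem' := by
    rintro ⟨c, x⟩ (h : SkewCommute c x v)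
    change SkewCommute c⁻¹ x⁻¹ v
    unfold SkewCommute at *
    rw [inv_mul_eq_iff_eq_mul, ← mul_assoc x, ← (units_map_algebraMap_commute c⁻¹ x).eq, mul_assoc,
      ← mul_assoc x, h, map_inv]
    group

namespace SkewCommute

variable {c d : Kˣ} {u u' v v' : Aˣ}

theorem mul_left (h : SkewCommute c u v) (h' : SkewCommute d u' v) :
    SkewCommute (c * d) (u * u') v :=
  (skewCentralizer v).mul_mem (x := (c, u)) (y := (d, u')) h h'

theorem zpow_left (h : SkewCommute c u v) (t : ℤ) : SkewCommute (c ^ t) (u ^ t) v :=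
  (skewCentralizer v).zpow_mem (x := (c, u)) h t

theorem symm (h : SkewCommute c u v) : SkewCommute c⁻¹ v u := by
  unfold SkewCommute at *
  rw [h, map_inv]
  group

theorem mul_right (h : SkewCommute c u v) (h' : SkewCommute d u v') :
    SkewCommute (c * d) u (v * v') := by
  simpa [mul_comm] using (h.symm.mul_left h'.symm).symm

theorem zpow_right (h : SkewCommute c u v) (t : ℤ) : SkewCommute (c ^ t) u (v ^ t) := by
  simpa using (h.symm.zpow_left t).symm

theorem map {B : Type*} [Semiring B] [Algebra K B] (f : A →ₐ[K] B) (h : SkewCommute c u v) :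
    SkewCommute c (Units.map (f : A →* B) u) (Units.map (f : A →* B) v) := by
  rw [skewCommute_iff] at *
  simpa using congrArg f h

end SkewCommute

end SkewCommute

theorem adjoin_mkAlgHom_ι_eq_top {R X : Type*} [CommSemiring R]
    (r : FreeAlgebra R X → FreeAlgebra R X → Prop) :
    Algebra.adjoin R (Set.range fun i => RingQuot.mkAlgHom R r (FreeAlgebra.ι R i)) = ⊤ := by
  rw [Set.range_comp' (RingQuot.mkAlgHom R r), ← AlgHom.map_adjoin, FreeAlgebra.adjoin_range_ι,
    Algebra.map_top, AlgHom.range_eq_top]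
  exact RingQuot.mkAlgHom_surjective R r

namespace QAffine

variable {K : Type u} [Field K] {n : ℕ} {q : Matrix (Fin n) (Fin n) Kˣ}

theorem x_mul_x (i j : Fin n) : x q i * x q j = (q i j : K) • (x q j * x q i) := by
  simp only [x]
  rw [← map_mul, RingQuot.mkAlgHom_rel K (AffineRel.comm i j), map_smul, map_mul]

theorem adjoin_x_eq_top : Algebra.adjoin K (Set.range (x q)) = ⊤ :=
  adjoin_mkAlgHom_ι_eq_top (AffineRel q)

/-- The universal property of quantum affine space. -/
noncomputable def lift {A : Type*} [Semiring A] [Algebra K A] (w : Fin n → A)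
    (h : ∀ i j, w i * w j = (q i j : K) • (w j * w i)) : QAffine q →ₐ[K] A :=
  RingQuot.liftAlgHom K ⟨FreeAlgebra.lift K w, by
    rintro _ _ ⟨i, j⟩
    simpa using h i j⟩

@[simp]
theorem lift_x {A : Type*} [Semiring A] [Algebra K A] (w : Fin n → A)
    (h : ∀ i j, w i * w j = (q i j : K) • (w j * w i)) (i : Fin n) :
    lift w h (x q i) = w i := by
  simp [lift, x]

end QAffine

namespace QTorus

variable {K : Type u} [Field K] {n : ℕ} (q : Matrix (Fin n) (Fin n) Kˣ)

/-- The generator `x i` of the quantum torus, as a unit. -/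
noncomputable def x (i : Fin n) : (QTorus q)ˣ where
  val := RingQuot.mkAlgHom K (TorusRel q) (FreeAlgebra.ι K (Sum.inl i))
  inv := RingQuot.mkAlgHom K (TorusRel q) (FreeAlgebra.ι K (Sum.inr i))
  val_inv := by rw [← map_mul, RingQuot.mkAlgHom_rel K (TorusRel.mul_inv i), map_one]
  inv_val := by rw [← map_mul, RingQuot.mkAlgHom_rel K (TorusRel.inv_mul i), map_one]

theorem skewCommute_x (i j : Fin n) : SkewCommute (q i j) (x q i) (x q j) := by
  rw [skewCommute_iff]
  simp only [x]
  rw [← map_mul, RingQuot.mkAlgHom_rel K (TorusRel.comm i j), map_smul, map_mul]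

theorem adjoin_x_eq_top :
    Algebra.adjoin K (Set.range (fun i => (x q i : QTorus q)) ∪
      Set.range (fun i => (↑(x q i)⁻¹ : QTorus q))) = ⊤ := by
  rw [← adjoin_mkAlgHom_ι_eq_top (TorusRel q), Sum.range_eq]
  rfl

variable {q} {A : Type*} [Semiring A] [Algebra K A]

/-- The universal property of the quantum torus. -/
noncomputable def lift (w : Fin n → Aˣ) (h : ∀ i j, SkewCommute (q i j) (w i) (w j)) :
    QTorus q →ₐ[K] A :=
  RingQuot.liftAlgHom K ⟨FreeAlgebra.lift K (Sum.elim (fun i => (w i : A)) fun i => ↑(w i)⁻¹), by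
    rintro _ _ (⟨i, j⟩ | i | i)
    · simpa using skewCommute_iff.mp (h i j)
    · simp
    · simp⟩

@[simp]
theorem lift_x (w : Fin n → Aˣ) (h : ∀ i j, SkewCommute (q i j) (w i) (w j)) (i : Fin n) :
    lift w h (x q i) = w i := by
  simp [lift, x]

@[simp]
theorem map_lift_x (w : Fin n → Aˣ) (h : ∀ i j, SkewCommute (q i j) (w i) (w j)) (i : Fin n) :
    Units.map (lift w h : QTorus q →* A) (x q i) = w i :=
  Units.ext (lift_x w h i)

theorem algHom_ext {f g : QTorus q →ₐ[K] A} (h : ∀ i, f (x q i) = g (x q i)) : f = g := by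
  apply RingQuot.ringQuot_ext'
  apply FreeAlgebra.hom_ext
  funext i
  rcases i with i | i
  · exact h i
  · have : Units.map (f : QTorus q →* A) (x q i) = Units.map (g : QTorus q →* A) (x q i) :=
      Units.ext (h i)
    exact congrArg (fun w : Aˣ => (↑w⁻¹ : A)) this

end QTorus

section Transvection

variable {ι G : Type*} [CommGroup G] {q : Matrix ι ι G} {i j : ι}

/-- The condition `IsMulAntisymm` for a matrix with entries in an arbitrary commutative group,
with an arbitrary index type. -/
def IsAlternating (q : Matrix ι ι G) : Prop :=
  (∀ i, q i i = 1) ∧ ∀ i j, q j i = (q i j)⁻¹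

variable [DecidableEq ι]

/-- The parameters of the generators obtained from `x` by replacing `x i` by `x i * x j ^ t`. -/
def transvect (q : Matrix ι ι G) (i j : ι) (t : ℤ) : Matrix ι ι G :=
  fun a b => q a b * (if a = i then q j b ^ t else 1) * (if b = i then q a j ^ t else 1)

theorem transvect_of_ne {a b : ι} (t : ℤ) (ha : a ≠ i) (hb : b ≠ i) :
    transvect q i j t a b = q a b := by
  simp [transvect, ha, hb]

theorem transvect_left {b : ι} (t : ℤ) (hb : b ≠ i) :
    transvect q i j t i b = q i b * q j b ^ t := by
  simp [transvect, hb]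

theorem transvect_right {a : ι} (t : ℤ) (ha : a ≠ i) :
    transvect q i j t a i = q a i * q a j ^ t := by
  simp [transvect, ha]

theorem IsAlternating.transvect (hq : IsAlternating q) (t : ℤ) :
    IsAlternating (transvect q i j t) := by
  constructor
  · intro a
    by_cases ha : a = i
    · subst ha
      simp [QuantumSpace.transvect, hq.1, hq.2 a j]
    · simp [QuantumSpace.transvect, hq.1, ha]
  · intro a b
    simp only [QuantumSpace.transvect]
    rw [hq.2 a b, hq.2 a j, hq.2 j b]
    split_ifs <;> simp [mul_assoc, mul_comm, mul_left_comm]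

theorem transvect_neg (hq : IsAlternating q) (hij : i ≠ j) (t : ℤ) :
    transvect (transvect q i j t) i j (-t) = q := by
  funext a b
  by_cases ha : a = i <;> by_cases hb : b = i
  · subst ha hb
    rw [(hq.transvect t |>.transvect (-t)).1, hq.1]
  · subst ha
    rw [transvect_left _ hb, transvect_left _ hb, transvect_of_ne _ hij.symm hb]
    simp
  · subst hb
    rw [transvect_right _ ha, transvect_right _ ha, transvect_of_ne _ ha hij.symm]
    simp
  · rw [transvect_of_ne _ ha hb, transvect_of_ne _ ha hb]

/-- `Reach S q q'` holds if `q'` arises from `q` by transvections with indices in `S`. -/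
def Reach (S : Finset ι) : Matrix ι ι G → Matrix ι ι G → Prop :=
  Relation.ReflTransGen fun q q' => ∃ i ∈ S, ∃ j ∈ S, i ≠ j ∧ ∃ t, q' = transvect q i j t

namespace Reach

variable {S T : Finset ι} {q' q'' : Matrix ι ι G}

theorem refl (S : Finset ι) (q : Matrix ι ι G) : Reach S q q :=
  Relation.ReflTransGen.refl

theorem trans (h : Reach S q q') (h' : Reach S q' q'') : Reach S q q'' :=
  Relation.ReflTransGen.trans h h'

theorem transvect (hi : i ∈ S) (hj : j ∈ S) (hij : i ≠ j) (t : ℤ) :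
    Reach S q (transvect q i j t) :=
  .single ⟨i, hi, j, hj, hij, t, rfl⟩

theorem mono (h : Reach S q q') (hST : S ⊆ T) : Reach T q q' :=
  Relation.ReflTransGen.mono
    (fun _ _ ⟨i, hi, j, hj, ht⟩ => ⟨i, hST hi, j, hST hj, ht⟩) _ _ h

theorem isAlternating (h : Reach S q q') (hq : IsAlternating q) : IsAlternating q' := by
  induction h with
  | refl => exact hq
  | tail _ hstep ih =>
    obtain ⟨i, -, j, -, -, t, rfl⟩ := hstep
    exact ih.transvect t

theorem symm (h : Reach S q q') (hq : IsAlternating q) : Reach S q' q := by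
  induction h with
  | refl => exact refl S q
  | @tail q' _ h hstep ih =>
    obtain ⟨i, hi, j, hj, hij, t, rfl⟩ := hstep
    have hback : Reach S (QuantumSpace.transvect q' i j t) q' := by
      have := transvect (q := QuantumSpace.transvect q' i j t) hi hj hij (-t)
      rwa [transvect_neg (isAlternating h hq) hij] at this
    exact hback.trans ih

theorem mem_subgroup (h : Reach S q q') {H : Subgroup G}
    (hH : ∀ a ∈ S, ∀ b ∈ S, q a b ∈ H) : ∀ a ∈ S, ∀ b ∈ S, q' a b ∈ H := by
  induction h with
  | refl => exact hH
  | tail _ hstep ih =>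
    obtain ⟨i, -, j, hj, -, t, rfl⟩ := hstep
    intro a ha b hb
    refine mul_mem (mul_mem (ih a ha b hb) ?_) ?_ <;> split_ifs
    exacts [zpow_mem (ih _ hj _ hb) _, one_mem _, zpow_mem (ih _ ha _ hj) _, one_mem _]

theorem apply_eq_of_notMem (h : Reach S q q') {b : ι} (hb : b ∉ S)
    (hq : ∀ a ∈ S, q a b = 1) (a : ι) : q' a b = q a b := by
  induction h generalizing a with
  | refl => rfl
  | tail _ hstep ih =>
    obtain ⟨i, hi, j, hj, -, t, rfl⟩ := hstep
    have hbi : b ≠ i := fun h => hb (h ▸ hi)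
    by_cases ha : a = i
    · rw [ha, transvect_left _ hbi, ih, ih, hq j hj, one_zpow, mul_one]
    · rw [transvect_of_ne _ ha hbi, ih]

end Reach

end Transvection

theorem SkewCommute.transvect {K A ι : Type*} [CommSemiring K] [Semiring A] [Algebra K A]
    [DecidableEq ι] {q : Matrix ι ι Kˣ} {i j : ι} {w : ι → Aˣ} (hq : IsAlternating q)
    (h : ∀ a b, SkewCommute (q a b) (w a) (w b)) (t : ℤ) (a b : ι) :
    SkewCommute (transvect q i j t a b) (Function.update w i (w i * w j ^ t) a)
      (Function.update w i (w i * w j ^ t) b) := by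
  by_cases ha : a = i <;> by_cases hb : b = i
  · subst ha hb
    rw [(hq.transvect t).1, skewCommute_one_iff]
  · subst ha
    rw [transvect_left _ hb, Function.update_self, Function.update_of_ne hb]
    exact (h _ _).mul_left ((h _ _).zpow_left t)
  · subst hb
    rw [transvect_right _ ha, Function.update_self, Function.update_of_ne ha]
    exact (h _ _).mul_right ((h _ _).zpow_right t)
  · rw [transvect_of_ne _ ha hb, Function.update_of_ne ha, Function.update_of_ne hb]
    exact h _ _

section TransvectedTorus

variable {K : Type u} [Field K] {n : ℕ} {q q' : Matrix (Fin n) (Fin n) Kˣ} {i j : Fin n}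

theorem nonempty_algEquiv_transvect (hq : IsAlternating q) (hij : i ≠ j) (t : ℤ) :
    Nonempty (QTorus q ≃ₐ[K] QTorus (transvect q i j t)) := by
  have hinv := SkewCommute.transvect (i := i) (j := j) (hq.transvect t)
    (QTorus.skewCommute_x (transvect q i j t)) (-t)
  rw [transvect_neg hq hij] at hinv
  let f := QTorus.lift _ hinv
  let g := QTorus.lift _ (SkewCommute.transvect (i := i) (j := j) hq (QTorus.skewCommute_x q) t)
  refine ⟨AlgEquiv.ofAlgHom f g (QTorus.algHom_ext fun a => ?_) (QTorus.algHom_ext fun a => ?_)⟩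
  all_goals
    simp only [f, g, AlgHom.comp_apply, AlgHom.id_apply, QTorus.lift_x]
    by_cases ha : a = i
    · subst ha
      rw [Function.update_self, ← MonoidHom.coe_coe, ← Units.coe_map, map_mul, map_zpow,
        QTorus.map_lift_x, QTorus.map_lift_x, Function.update_self, Function.update_of_ne hij.symm]
      simp
    · rw [Function.update_of_ne ha, QTorus.lift_x, Function.update_of_ne ha]

theorem Reach.nonempty_algEquiv {S : Finset (Fin n)} (h : Reach S q q') (hq : IsAlternating q) :
    Nonempty (QTorus q ≃ₐ[K] QTorus q') := by
  induction h with
  | refl => exact ⟨AlgEquiv.refl⟩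
  | tail h hstep ih =>
    obtain ⟨i, -, j, -, hij, t, rfl⟩ := hstep
    exact ⟨ih.some.trans (nonempty_algEquiv_transvect (isAlternating h hq) hij t).some⟩

end TransvectedTorus

section ZPowers

variable {G : Type*} [Group G] {g : G}

theorem zpow_mem_zpowers_of_dvd (g : G) {d c : ℤ} (h : d ∣ c) :
    g ^ c ∈ Subgroup.zpowers (g ^ d) := by
  obtain ⟨k, rfl⟩ := h
  rw [zpow_mul]
  exact Subgroup.zpow_mem_zpowers _ _

theorem zpowers_pow_le_of_dvd (g : G) {d c : ℕ} (h : d ∣ c) :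
    Subgroup.zpowers (g ^ c) ≤ Subgroup.zpowers (g ^ d) := by
  obtain ⟨k, rfl⟩ := h
  rw [pow_mul, Subgroup.zpowers_le]
  exact Subgroup.npow_mem_zpowers _ _

theorem dvd_of_pow_mem_zpowers {d c : ℕ} (hd : d ∣ orderOf g)
    (h : g ^ c ∈ Subgroup.zpowers (g ^ d)) : d ∣ c := by
  obtain ⟨k, hk : (g ^ d) ^ k = g ^ c⟩ := h
  have hmod : (c : ℤ) ≡ d * k [ZMOD orderOf g] := by
    rw [← zpow_eq_zpow_iff_modEq, zpow_mul, zpow_natCast, zpow_natCast, hk]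
  have hdiff : (d : ℤ) ∣ d * k - c := (Int.natCast_dvd_natCast.mpr hd).trans hmod.dvd
  exact_mod_cast (dvd_sub_right (dvd_mul_right (d : ℤ) k)).mp hdiff

theorem zpowers_pow_gcd_orderOf (g : G) (c : ℕ) :
    Subgroup.zpowers (g ^ c.gcd (orderOf g)) = Subgroup.zpowers (g ^ c) := by
  refine le_antisymm ?_ (zpowers_pow_le_of_dvd g (Nat.gcd_dvd_left _ _))
  rw [Subgroup.zpowers_le, ← zpow_natCast g (c.gcd _), Nat.gcd_eq_gcd_ab, zpow_add, zpow_mul,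
    zpow_mul, zpow_natCast, zpow_natCast, pow_orderOf_eq_one, one_zpow, mul_one]
  exact Subgroup.zpow_mem_zpowers _ _

theorem exists_pow_eq_of_ne_one {a : G} (hg : IsOfFinOrder g) (ha : a ∈ Subgroup.zpowers g)
    (h1 : a ≠ 1) : ∃ c : ℕ, c ≠ 0 ∧ c < orderOf g ∧ a = g ^ c := by
  classical
  obtain ⟨c, hc, rfl⟩ := Finset.mem_image.mp (hg.mem_zpowers_iff_mem_range_orderOf.mp ha)
  refine ⟨c, ?_, Finset.mem_range.mp hc, rfl⟩
  rintro rfl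
  exact h1 (pow_zero g)

end ZPowers

section Pivot

variable {ι G : Type*} [DecidableEq ι] [CommGroup G] {g : G} {S : Finset ι} {q q' : Matrix ι ι G}
  {i j k : ι} {d : ℤ}

/-- An off-diagonal entry `q i j = g ^ d` of an alternating matrix with entries in the powers of
`g` such that no matrix reachable from `q` has an off-diagonal entry with a smaller exponent. The
exponent is an integer so that `i` and `j` may be exchanged. -/
structure IsMinPivot (g : G) (S : Finset ι) (q : Matrix ι ι G) (i j : ι) (d : ℤ) : Prop where
  alternating : IsAlternating q
  mem_zpowers : ∀ a ∈ S, ∀ b ∈ S, q a b ∈ Subgroup.zpowers g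
  left_mem : i ∈ S
  right_mem : j ∈ S
  ne : i ≠ j
  exponent_ne_zero : d ≠ 0
  apply_eq : q i j = g ^ d
  natAbs_le : ∀ q', Reach S q q' → ∀ a ∈ S, ∀ b ∈ S, a ≠ b → ∀ c : ℕ, c ≠ 0 → q' a b = g ^ c →
    d.natAbs ≤ c

theorem exists_isMinPivot (hg : IsOfFinOrder g) (hq : IsAlternating q)
    (hqg : ∀ a ∈ S, ∀ b ∈ S, q a b ∈ Subgroup.zpowers g) (hne : ∃ a ∈ S, ∃ b ∈ S, q a b ≠ 1) :
    ∃ q' i j, ∃ d : ℕ, Reach S q q' ∧ IsMinPivot g S q' i j d ∧ d < orderOf g := by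
  classical
  let IsExponent (d : ℕ) : Prop :=
    d ≠ 0 ∧ ∃ q', Reach S q q' ∧ ∃ a ∈ S, ∃ b ∈ S, a ≠ b ∧ q' a b = g ^ d
  obtain ⟨a, ha, b, hb, hab⟩ := hne
  obtain ⟨c, hc, hcg, hqab⟩ := exists_pow_eq_of_ne_one hg (hqg a ha b hb) hab
  have hne : a ≠ b := fun h => hab (h ▸ hq.1 a)
  have hcexp : IsExponent c := ⟨hc, q, .refl S q, a, ha, b, hb, hne, hqab⟩
  have hexp : ∃ d, IsExponent d := ⟨c, hcexp⟩
  obtain ⟨hd, q', hq', i, hi, j, hj, hij, hqij⟩ := Nat.find_spec hexp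
  refine ⟨q', i, j, Nat.find hexp, hq', ⟨hq'.isAlternating hq, hq'.mem_subgroup hqg, hi, hj, hij,
    by exact_mod_cast hd, by rw [hqij, zpow_natCast], ?_⟩, ?_⟩
  · intro q'' hq'' k hk l hl hkl c hc hqkl
    exact Nat.find_min' hexp ⟨hc, q'', hq'.trans hq'', k, hk, l, hl, hkl, hqkl⟩
  · exact (Nat.find_min' hexp hcexp).trans_lt hcg

namespace IsMinPivot

theorem of_reach (P : IsMinPivot g S q i j d) (h : Reach S q q') (hd : q' i j = g ^ d) :
    IsMinPivot g S q' i j d where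
  alternating := h.isAlternating P.alternating
  mem_zpowers := h.mem_subgroup P.mem_zpowers
  left_mem := P.left_mem
  right_mem := P.right_mem
  ne := P.ne
  exponent_ne_zero := P.exponent_ne_zero
  apply_eq := hd
  natAbs_le q'' h' := P.natAbs_le q'' (h.trans h')

theorem symm (P : IsMinPivot g S q i j d) : IsMinPivot g S q j i (-d) where
  alternating := P.alternating
  mem_zpowers := P.mem_zpowers
  left_mem := P.right_mem
  right_mem := P.left_mem
  ne := P.ne.symm
  exponent_ne_zero := neg_ne_zero.mpr P.exponent_ne_zero
  apply_eq := by rw [P.alternating.2, P.apply_eq, zpow_neg]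
  natAbs_le := by simpa only [Int.natAbs_neg] using P.natAbs_le

/-- Division with remainder by the pivot turns the entry `g ^ c` of its row into `g ^ (c % d)`. -/
theorem dvd_of_apply_eq (P : IsMinPivot g S q i j d) (hk : k ∈ S) (hki : k ≠ i) (hkj : k ≠ j)
    {c : ℤ} (hc : q i k = g ^ c) : d ∣ c := by
  refine Int.dvd_of_emod_eq_zero ?_
  by_contra hr
  have hr0 := Int.emod_nonneg c P.exponent_ne_zero
  have hentry : transvect q k j (-(c / d)) i k = g ^ (c % d).toNat := by
    rw [transvect_right _ hki.symm, hc, P.apply_eq, ← zpow_mul, ← zpow_add, ← zpow_natCast,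
      Int.toNat_of_nonneg hr0, Int.emod_def, mul_neg, sub_eq_add_neg]
  have hle := P.natAbs_le _ (.transvect hk P.right_mem hkj _) i P.left_mem k hk hki.symm _
    (by omega) hentry
  have hlt := Int.emod_lt_abs c P.exponent_ne_zero
  rw [Int.abs_eq_natAbs] at hlt
  omega

theorem dvd_orderOf (P : IsMinPivot g S q i j d) (hS : 3 ≤ S.card) : d ∣ orderOf g := by
  obtain ⟨k, hk, hkij⟩ : ∃ k ∈ S, k ∉ ({i, j} : Finset ι) :=
    Finset.exists_mem_notMem_of_card_lt_card (Finset.card_le_two.trans_lt hS)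
  simp only [Finset.mem_insert, Finset.mem_singleton, not_or] at hkij
  obtain ⟨c, hc : g ^ c = q i k⟩ := P.mem_zpowers i P.left_mem k hk
  have hdc := P.dvd_of_apply_eq hk hkij.1 hkij.2 hc.symm
  have hdcm : d ∣ c + orderOf g := P.dvd_of_apply_eq hk hkij.1 hkij.2 (by
    rw [← hc, zpow_add, zpow_natCast, pow_orderOf_eq_one, mul_one])
  exact (dvd_add_right hdc).mp hdcm

theorem exists_transvect_clear (P : IsMinPivot g S q i j d) (hk : k ∈ S) (hki : k ≠ i)
    (hkj : k ≠ j) : ∃ t, IsMinPivot g S (transvect q k j t) i j d ∧ transvect q k j t i k = 1 := by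
  obtain ⟨c, hc : g ^ c = q i k⟩ := P.mem_zpowers i P.left_mem k hk
  obtain ⟨t, rfl⟩ := P.dvd_of_apply_eq hk hki hkj hc.symm
  refine ⟨-t, P.of_reach (.transvect hk P.right_mem hkj _) ?_, ?_⟩
  · rw [transvect_of_ne _ hki.symm hkj.symm, P.apply_eq]
  · rw [transvect_right _ hki.symm, ← hc, P.apply_eq, zpow_mul, zpow_neg, mul_inv_cancel]

theorem exists_reach_clear_index (P : IsMinPivot g S q i j d) (hk : k ∈ S) (hki : k ≠ i)
    (hkj : k ≠ j) : ∃ q', Reach S q q' ∧ IsMinPivot g S q' i j d ∧ (q' i k = 1 ∧ q' j k = 1) ∧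
      ∀ l ≠ k, q' i l = q i l ∧ q' j l = q j l := by
  obtain ⟨t, P₁, h₁⟩ := P.exists_transvect_clear hk hki hkj
  obtain ⟨t', P₂, h₂⟩ := P₁.symm.exists_transvect_clear hk hkj hki
  refine ⟨_, (Reach.transvect hk P.right_mem hkj t).trans (.transvect hk P.left_mem hki t'),
    by simpa using P₂.symm, ⟨?_, h₂⟩, fun l hl => ⟨?_, ?_⟩⟩
  · rw [transvect_right _ hki.symm, h₁, P₁.alternating.1, one_zpow, mul_one]
  · rw [transvect_of_ne _ hki.symm hl, transvect_of_ne _ hki.symm hl]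
  · rw [transvect_of_ne _ hkj.symm hl, transvect_of_ne _ hkj.symm hl]

theorem exists_reach_clear (P : IsMinPivot g S q i j d) :
    ∃ q', Reach S q q' ∧ IsMinPivot g S q' i j d ∧
      ∀ k ∈ S, k ≠ i → k ≠ j → q' i k = 1 ∧ q' j k = 1 := by
  suffices ∀ T ⊆ S, ∃ q', Reach S q q' ∧ IsMinPivot g S q' i j d ∧
      ∀ k ∈ T, k ≠ i → k ≠ j → q' i k = 1 ∧ q' j k = 1 from this S subset_rfl
  intro T
  induction T using Finset.induction_on with
  | empty => exact fun _ => ⟨q, .refl S q, P, by simp⟩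
  | insert k T hkT ih =>
    intro hT
    obtain ⟨hk, hT⟩ := Finset.insert_subset_iff.mp hT
    obtain ⟨q₁, h₁, P₁, hclear⟩ := ih hT
    by_cases hkij : k = i ∨ k = j
    · refine ⟨q₁, h₁, P₁, fun l hl hli hlj => ?_⟩
      rcases Finset.mem_insert.mp hl with rfl | hl
      · exact absurd hkij (not_or.mpr ⟨hli, hlj⟩)
      · exact hclear l hl hli hlj
    · obtain ⟨hki, hkj⟩ := not_or.mp hkij
      obtain ⟨q₂, h₂, P₂, hk₂, hsame⟩ := P₁.exists_reach_clear_index hk hki hkj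
      refine ⟨q₂, h₁.trans h₂, P₂, fun l hl hli hlj => ?_⟩
      rcases Finset.mem_insert.mp hl with rfl | hl
      · exact hk₂
      · rw [(hsame l (ne_of_mem_of_not_mem hl hkT)).1, (hsame l (ne_of_mem_of_not_mem hl hkT)).2]
        exact hclear l hl hli hlj

theorem row_mem_zpowers (P : IsMinPivot g S q i j d)
    (hclear : ∀ k ∈ S, k ≠ i → k ≠ j → q i k = 1 ∧ q j k = 1) :
    ∀ b ∈ S, q i b ∈ Subgroup.zpowers (g ^ d) := by
  intro b hb
  by_cases hbi : b = i
  · rw [hbi, P.alternating.1]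
    exact one_mem _
  by_cases hbj : b = j
  · rw [hbj, P.apply_eq]
    exact Subgroup.mem_zpowers _
  rw [(hclear b hb hbi hbj).1]
  exact one_mem _

/-- Adding the row of `a` to the cleared row of `i` moves the entry `q a b` into the row of the
pivot. -/
theorem apply_mem_zpowers (P : IsMinPivot g S q i j d)
    (hclear : ∀ k ∈ S, k ≠ i → k ≠ j → q i k = 1 ∧ q j k = 1) :
    ∀ a ∈ S, ∀ b ∈ S, q a b ∈ Subgroup.zpowers (g ^ d) := by
  have hrow_i := P.row_mem_zpowers hclear
  have hrow_j : ∀ b ∈ S, q j b ∈ Subgroup.zpowers (g ^ d) := by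
    have := P.symm.row_mem_zpowers fun k hk hkj hki => (hclear k hk hki hkj).symm
    rwa [zpow_neg, Subgroup.zpowers_inv] at this
  intro a ha b hb
  by_cases hai : a = i
  · exact hai ▸ hrow_i b hb
  by_cases haj : a = j
  · exact haj ▸ hrow_j b hb
  by_cases hbi : b = i
  · rw [hbi, P.alternating.2 i a]
    exact inv_mem (hrow_i a ha)
  by_cases hbj : b = j
  · rw [hbj, P.alternating.2 j a]
    exact inv_mem (hrow_j a ha)
  obtain ⟨c, hc : g ^ c = q a b⟩ := P.mem_zpowers a ha b hb
  have P' : IsMinPivot g S (transvect q i a 1) i j d :=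
    P.of_reach (.transvect P.left_mem ha (Ne.symm hai) 1) (by
      rw [transvect_left _ P.ne.symm, P.alternating.2 j a, (hclear a ha hai haj).2, P.apply_eq,
        inv_one, one_zpow, mul_one])
  rw [← hc]
  refine zpow_mem_zpowers_of_dvd g (P'.dvd_of_apply_eq hb hbi hbj ?_)
  rw [transvect_left _ hbi, (hclear b hb hbi hbj).1, hc, zpow_one, one_mul]

end IsMinPivot

end Pivot

section BlockDecomposition

variable {ι G : Type*} [CommGroup G] {q : Matrix ι ι G} {S : Finset ι} {i j : ι} {s : ℕ}

/-- On the index set `S` the alternating matrix `q` is a direct sum of rank two blocks at the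
pairs `(e (k, 0), e (k, 1))` with parameters `ε k`, and of a trivial part. -/
structure IsBlockDecomp (q : Matrix ι ι G) (S : Finset ι) {σ : Type*} (ε : σ → G)
    (e : σ × Fin 2 → ι) : Prop where
  injective : Function.Injective e
  mem : ∀ p, e p ∈ S
  apply_eq : ∀ k, q (e (k, 0)) (e (k, 1)) = ε k
  eq_one : ∀ a ∈ S, ∀ b ∈ S, q a b ≠ 1 →
    ∃ k, (a = e (k, 0) ∧ b = e (k, 1)) ∨ (a = e (k, 1) ∧ b = e (k, 0))

theorem isBlockDecomp_of_isEmpty {σ : Type*} [IsEmpty σ] (hS : ∀ a ∈ S, ∀ b ∈ S, q a b = 1)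
    (ε : σ → G) (e : σ × Fin 2 → ι) : IsBlockDecomp q S ε e where
  injective := Function.injective_of_subsingleton e
  mem p := isEmptyElim p
  apply_eq := isEmptyElim
  eq_one a ha b hb hab := absurd (hS a ha b hb) hab

theorem IsBlockDecomp.mem_zpowers {σ : Type*} {ε : σ → G} {e : σ × Fin 2 → ι}
    (H : IsBlockDecomp q S ε e) (hq : IsAlternating q) {γ : G}
    (hε : ∀ k, ε k ∈ Subgroup.zpowers γ) :
    ∀ a ∈ S, ∀ b ∈ S, q a b ∈ Subgroup.zpowers γ := by
  intro a ha b hb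
  by_cases hab : q a b = 1
  · exact hab ▸ one_mem _
  obtain ⟨k, ⟨rfl, rfl⟩ | ⟨rfl, rfl⟩⟩ := H.eq_one a ha b hb hab
  · exact H.apply_eq k ▸ hε k
  · rw [hq.2, H.apply_eq]
    exact inv_mem (hε k)

/-- The pair `(i, j)`, followed by the pairs `(e (k, 0), e (k, 1))`. -/
def consPair (i j : ι) (e : Fin s × Fin 2 → ι) (p : Fin (s + 1) × Fin 2) : ι :=
  Fin.cons (α := fun _ => Fin 2 → ι) ![i, j] (fun k a => e (k, a)) p.1 p.2

theorem forall_fin_succ_prod_fin_two {P : Fin (s + 1) × Fin 2 → Prop} :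
    (∀ p, P p) ↔ P (0, 0) ∧ P (0, 1) ∧ ∀ k a, P (Fin.succ k, a) := by
  rw [Prod.forall, Fin.forall_fin_succ, Fin.forall_fin_two, and_assoc]

theorem injective_consPair (hij : i ≠ j) {e : Fin s × Fin 2 → ι} (he : Function.Injective e)
    (hi : ∀ p, e p ≠ i) (hj : ∀ p, e p ≠ j) : Function.Injective (consPair i j e) := by
  have hsucc (k a) : consPair i j e (Fin.succ k, a) = e (k, a) := rfl
  have hzero : consPair i j e (0, 0) = i := rfl
  have hone : consPair i j e (0, 1) = j := rfl
  simp only [Function.Injective, forall_fin_succ_prod_fin_two, hsucc, hzero, hone, he.eq_iff]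
  grind [Fin.succ_inj]

theorem IsBlockDecomp.cons [DecidableEq ι] (hq : IsAlternating q) (hi : i ∈ S) (hj : j ∈ S)
    (hij : i ≠ j) (hclear : ∀ k ∈ S, k ≠ i → k ≠ j → q i k = 1 ∧ q j k = 1)
    {ε : Fin s → G} {e : Fin s × Fin 2 → ι} (H : IsBlockDecomp q ((S.erase i).erase j) ε e) :
    IsBlockDecomp q S (Fin.cons (q i j) ε : Fin (s + 1) → G) (consPair i j e) where
  injective := injective_consPair hij H.injective
    (fun p => Finset.ne_of_mem_erase (Finset.mem_of_mem_erase (H.mem p)))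
    (fun p => Finset.ne_of_mem_erase (H.mem p))
  mem := forall_fin_succ_prod_fin_two.mpr
    ⟨hi, hj, fun k a => Finset.mem_of_mem_erase (Finset.mem_of_mem_erase (H.mem (k, a)))⟩
  apply_eq := Fin.cases rfl H.apply_eq
  eq_one a ha b hb hab := by
    have hba : q b a ≠ 1 := by rwa [hq.2 a b, inv_ne_one]
    have hne : a ≠ b := fun h => hab (h ▸ hq.1 a)
    by_cases hai : a = i
    · exact ⟨0, .inl ⟨hai, by_contra fun hbj => hab <| hai ▸ (hclear b hb (hai ▸ hne.symm) hbj).1⟩⟩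
    by_cases haj : a = j
    · exact ⟨0, .inr ⟨haj, by_contra fun hbi => hab <| haj ▸ (hclear b hb hbi (haj ▸ hne.symm)).2⟩⟩
    have hbi : b ≠ i := fun hbi => hba <| hbi ▸ (hclear a ha hai haj).1
    have hbj : b ≠ j := fun hbj => hba <| hbj ▸ (hclear a ha hai haj).2
    obtain ⟨k, hk⟩ := H.eq_one a (by simp [ha, hai, haj]) b (by simp [hb, hbi, hbj]) hab
    exact ⟨k.succ, hk⟩

theorem isBlockDecomp_pair [DecidableEq ι] (hq : IsAlternating q) (hij : i ≠ j) :
    IsBlockDecomp q {i, j} (fun _ : Fin 1 => q i j) (consPair i j fun p => p.1.elim0) := by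
  have hempty : IsBlockDecomp q ((({i, j} : Finset ι).erase i).erase j) (Fin.elim0 : Fin 0 → G)
      fun p => p.1.elim0 := isBlockDecomp_of_isEmpty (by simp [hij]) _ _
  convert hempty.cons hq (by simp) (by simp) hij (by simp) with k
  rw [Subsingleton.elim k 0, Fin.cons_zero]

end BlockDecomposition

section ExponentChain

variable {G : Type*} [Group G] {g : G} {s : ℕ}

/-- The arithmetic conditions on the exponents of a normal form of rank `N`. The condition on the
orders is replaced by the equality of the generated subgroups. -/
structure IsExponentChain (g : G) (N : ℕ) (h : Fin s → ℕ) (z : ℕ) : Prop where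
  dvd : ∀ i, h i ∣ orderOf g
  lt : ∀ i, h i < orderOf g
  chain : ∀ i j, i ≤ j → h i ∣ h j
  zpowers_eq : ∀ i, Subgroup.zpowers (g ^ normalExp N h z i) = Subgroup.zpowers (g ^ h i)

theorem isExponentChain_of_isEmpty (g : G) (N : ℕ) (h : Fin 0 → ℕ) (z : ℕ) :
    IsExponentChain g N h z :=
  ⟨fun i => i.elim0, fun i => i.elim0, fun i => i.elim0, fun i => i.elim0⟩

theorem normalExp_two_one (h : Fin 1 → ℕ) (z : ℕ) (i : Fin 1) : normalExp 2 h z i = z * h i := by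
  rw [normalExp, if_pos ⟨rfl, by omega⟩]

theorem normalExp_cons_zero {N : ℕ} (hN : N ≠ 0) (d : ℕ) (h : Fin s → ℕ) (z : ℕ) :
    normalExp (N + 2) (Fin.cons d h : Fin (s + 1) → ℕ) z 0 = d := by
  rw [normalExp, if_neg, Fin.cons_zero]
  simp only [Fin.val_zero]
  omega

theorem normalExp_cons_succ (N d : ℕ) (h : Fin s → ℕ) (z : ℕ) (i : Fin s) :
    normalExp (N + 2) (Fin.cons d h : Fin (s + 1) → ℕ) z i.succ = normalExp N h z i := by
  simp only [normalExp, Fin.cons_succ, Fin.val_succ]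
  congr 1
  simp only [eq_iff_iff]
  constructor <;> rintro ⟨h1, h2⟩ <;> constructor <;> omega

theorem isExponentChain_gcd {c : ℕ} (hc : c ≠ 0) (hcg : c < orderOf g) :
    IsExponentChain g 2 (fun _ : Fin 1 => c.gcd (orderOf g)) (c / c.gcd (orderOf g)) where
  dvd _ := Nat.gcd_dvd_right _ _
  lt _ := (Nat.gcd_le_left _ (Nat.pos_of_ne_zero hc)).trans_lt hcg
  chain _ _ _ := dvd_rfl
  zpowers_eq i := by
    rw [normalExp_two_one, Nat.div_mul_cancel (Nat.gcd_dvd_left _ _), zpowers_pow_gcd_orderOf]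

theorem IsExponentChain.cons {N : ℕ} {h : Fin s → ℕ} {z : ℕ} (H : IsExponentChain g N h z)
    (hN : N ≠ 0) {d : ℕ} (hd : d ∣ orderOf g) (hdg : d < orderOf g) (hdh : ∀ k, d ∣ h k) :
    IsExponentChain g (N + 2) (Fin.cons d h : Fin (s + 1) → ℕ) z where
  dvd := Fin.cases hd H.dvd
  lt := Fin.cases hdg H.lt
  chain k l hkl := by
    cases k using Fin.cases <;> cases l using Fin.cases
    · exact dvd_rfl
    · exact hdh _
    · exact absurd hkl (Fin.succ_pos _).not_ge
    · exact H.chain _ _ (Fin.succ_le_succ_iff.mp hkl)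
  zpowers_eq := Fin.cases (by rw [normalExp_cons_zero hN, Fin.cons_zero])
    fun k => by rw [normalExp_cons_succ, Fin.cons_succ, H.zpowers_eq k]

end ExponentChain

section Reduction

variable {ι G : Type*} [CommGroup G] [DecidableEq ι] {g : G} {S : Finset ι}

/-- One step of the reduction to block form: the row and column of the pair `(i, j)` are cleared,
and the remaining entries, on the smaller index set, are powers of `q i j = g ^ d`. -/
structure IsSplitPivot (g : G) (S : Finset ι) (q : Matrix ι ι G) (i j : ι) (d : ℕ) : Prop where
  left_mem : i ∈ S
  right_mem : j ∈ S
  ne : i ≠ j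
  dvd : d ∣ orderOf g
  lt : d < orderOf g
  apply_eq : q i j = g ^ d
  clear : ∀ k ∈ S, k ≠ i → k ≠ j → q i k = 1 ∧ q j k = 1
  mem_zpowers : ∀ a ∈ S, ∀ b ∈ S, q a b ∈ Subgroup.zpowers (g ^ d)

theorem exists_reach_isSplitPivot (hg : IsOfFinOrder g) (hS : 3 ≤ S.card) {q : Matrix ι ι G}
    (hq : IsAlternating q) (hqg : ∀ a ∈ S, ∀ b ∈ S, q a b ∈ Subgroup.zpowers g)
    (hne : ∃ a ∈ S, ∃ b ∈ S, q a b ≠ 1) :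
    ∃ q' i j d, Reach S q q' ∧ IsSplitPivot g S q' i j d := by
  obtain ⟨q₁, i, j, d, h₁, P₁, hdg⟩ := exists_isMinPivot hg hq hqg hne
  obtain ⟨q₂, h₂, P₂, hclear⟩ := P₁.exists_reach_clear
  have hmem := P₂.apply_mem_zpowers hclear
  rw [zpow_natCast] at hmem
  exact ⟨q₂, i, j, d, h₁.trans h₂, P₂.left_mem, P₂.right_mem, P₂.ne,
    Int.natCast_dvd_natCast.mp (P₂.dvd_orderOf hS), hdg, by rw [P₂.apply_eq, zpow_natCast],
    hclear, hmem⟩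

theorem IsSplitPivot.apply_eq_of_reach {q q' : Matrix ι ι G} {i j : ι} {d : ℕ}
    (P : IsSplitPivot g S q i j d) (hq : IsAlternating q)
    (h : Reach ((S.erase i).erase j) q q') {b : ι} (hb : b = i ∨ b = j) (a : ι) :
    q' a b = q a b := by
  refine h.apply_eq_of_notMem (by rcases hb with rfl | rfl <;> simp) (fun k hk => ?_) a
  simp only [Finset.mem_erase] at hk
  obtain ⟨hki, hkj⟩ := P.clear k hk.2.2 hk.2.1 hk.1
  rcases hb with rfl | rfl
  · rw [hq.2 b k, hki, inv_one]
  · rw [hq.2 b k, hkj, inv_one]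

theorem IsSplitPivot.of_reach {q q' : Matrix ι ι G} {i j : ι} {d : ℕ}
    (P : IsSplitPivot g S q i j d) (hq : IsAlternating q)
    (h : Reach ((S.erase i).erase j) q q') : IsSplitPivot g S q' i j d := by
  have hS : (S.erase i).erase j ⊆ S := (Finset.erase_subset _ _).trans (Finset.erase_subset _ _)
  have hq' := h.isAlternating hq
  refine { P with
    apply_eq := by rw [P.apply_eq_of_reach hq h (.inr rfl), P.apply_eq]
    clear := fun k hk hki hkj => ?_
    mem_zpowers := (h.mono hS).mem_subgroup P.mem_zpowers }
  rw [hq'.2 k i, hq'.2 k j, P.apply_eq_of_reach hq h (.inl rfl),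
    P.apply_eq_of_reach hq h (.inr rfl), ← hq.2, ← hq.2]
  exact P.clear k hk hki hkj

theorem IsExponentChain.dvd_of_mem_zpowers {N s : ℕ} {h : Fin s → ℕ} {z : ℕ}
    (H : IsExponentChain g N h z) {d : ℕ} (hd : d ∣ orderOf g) {k : Fin s}
    (hk : g ^ normalExp N h z k ∈ Subgroup.zpowers (g ^ d)) : d ∣ h k := by
  rw [← Subgroup.zpowers_le, H.zpowers_eq, Subgroup.zpowers_le] at hk
  exact dvd_of_pow_mem_zpowers hd hk

theorem exists_isBlockDecomp_pair (hg : IsOfFinOrder g) {q : Matrix ι ι G} (hq : IsAlternating q)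
    {i j : ι} (hij : i ≠ j) (hqij : q i j ∈ Subgroup.zpowers g) (hne : q i j ≠ 1) :
    ∃ (h : Fin 1 → ℕ) (z : ℕ) (e : Fin 1 × Fin 2 → ι), IsExponentChain g 2 h z ∧
      IsBlockDecomp q {i, j} (fun k => g ^ normalExp 2 h z k) e := by
  obtain ⟨c, hc, hcg, hqc⟩ := exists_pow_eq_of_ne_one hg hqij hne
  refine ⟨_, _, consPair i j fun p => p.1.elim0, isExponentChain_gcd hc hcg, ?_⟩
  convert isBlockDecomp_pair hq hij
  rw [normalExp_two_one, Nat.div_mul_cancel (Nat.gcd_dvd_left _ _), hqc]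

theorem exists_reach_isBlockDecomp (hg : IsOfFinOrder g) (S : Finset ι) {q : Matrix ι ι G}
    (hq : IsAlternating q) (hqg : ∀ a ∈ S, ∀ b ∈ S, q a b ∈ Subgroup.zpowers g) :
    ∃ (q' : Matrix ι ι G) (s : ℕ) (h : Fin s → ℕ) (z : ℕ) (e : Fin s × Fin 2 → ι), Reach S q q' ∧
      IsExponentChain g S.card h z ∧
      IsBlockDecomp q' S (fun k => g ^ normalExp S.card h z k) e := by
  induction S using Finset.strongInduction generalizing q with
  | H S ih =>
  by_cases htriv : ∀ a ∈ S, ∀ b ∈ S, q a b = 1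
  · exact ⟨q, 0, Fin.elim0, 0, fun p => p.1.elim0, .refl S q, isExponentChain_of_isEmpty _ _ _ _,
      isBlockDecomp_of_isEmpty htriv _ _⟩
  push Not at htriv
  obtain hS | hS := le_or_gt 3 S.card
  · obtain ⟨q₁, i, j, d, h₁, P₁⟩ := exists_reach_isSplitPivot hg hS hq hqg htriv
    have hq₁ := h₁.isAlternating hq
    have hsub : (S.erase i).erase j ⊂ S :=
      (Finset.erase_subset _ _).trans_ssubset (Finset.erase_ssubset P₁.left_mem)
    have hcard : S.card = ((S.erase i).erase j).card + 2 := by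
      have := Finset.card_erase_add_one P₁.left_mem
      have := Finset.card_erase_add_one (Finset.mem_erase.mpr ⟨P₁.ne.symm, P₁.right_mem⟩)
      omega
    obtain ⟨q₂, s, h, z, e, h₂, hchain, hblock⟩ := ih _ hsub hq₁ fun a ha b hb =>
      h₁.mem_subgroup hqg a (hsub.subset ha) b (hsub.subset hb)
    have P₂ := P₁.of_reach hq₁ h₂
    have hdh (k) : d ∣ h k := hchain.dvd_of_mem_zpowers P₂.dvd <| hblock.apply_eq k ▸
      P₂.mem_zpowers _ (hsub.subset (hblock.mem _)) _ (hsub.subset (hblock.mem _))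
    refine ⟨q₂, s + 1, Fin.cons d h, z, consPair i j e, h₁.trans (h₂.mono hsub.subset),
      hcard ▸ hchain.cons (by omega) P₂.dvd P₂.lt hdh, ?_⟩
    convert hblock.cons (h₂.isAlternating hq₁) P₂.left_mem P₂.right_mem P₂.ne P₂.clear with k
    cases k using Fin.cases with
    | zero => rw [hcard, normalExp_cons_zero (by omega), Fin.cons_zero, P₂.apply_eq]
    | succ k => rw [hcard, normalExp_cons_succ, Fin.cons_succ]
  · obtain ⟨i, hi, j, hj, hne⟩ := htriv
    have hij : i ≠ j := fun h => hne (h ▸ hq.1 i)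
    obtain rfl : S = {i, j} := (Finset.eq_of_subset_of_card_le
      (by simp [Finset.insert_subset_iff, hi, hj]) (by rw [Finset.card_pair hij]; omega)).symm
    obtain ⟨h, z, e, hchain, hblock⟩ :=
      exists_isBlockDecomp_pair hg hq hij (hqg i hi j hj) hne
    exact ⟨q, 1, h, z, e, .refl _ q, by rwa [Finset.card_pair hij],
      by rwa [Finset.card_pair hij]⟩

end Reduction

section CommutingLift

theorem update_eq_mulSingle_mul {ι : Type*} [DecidableEq ι] {M : ι → Type*}
    [∀ i, MulOneClass (M i)] (m : ∀ i, M i) (i : ι) (a : M i) :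
    Function.update m i a = Pi.mulSingle i a * Function.update m i 1 := by
  ext j
  obtain rfl | hj := eq_or_ne j i <;> simp [*]

theorem noncommPiCoprod_update {ι : Type*} [Fintype ι] [DecidableEq ι] {N : ι → Type*}
    [∀ i, Monoid (N i)] {M : Type*} [Monoid M] (φ : ∀ i, N i →* M)
    (hφ : Pairwise fun i j => ∀ a b, Commute (φ i a) (φ j b)) (m : ∀ i, N i) (i : ι) (a : N i) :
    MonoidHom.noncommPiCoprod φ hφ (Function.update m i a) =
      φ i a * MonoidHom.noncommPiCoprod φ hφ (Function.update m i 1) := by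
  rw [update_eq_mulSingle_mul, map_mul, MonoidHom.noncommPiCoprod_mulSingle]

variable {K ι B : Type*} [CommSemiring K] [Fintype ι] [DecidableEq ι] [Semiring B] [Algebra K B]
  {A : ι → Type*} [∀ i, Semiring (A i)] [∀ i, Algebra K (A i)] (f : ∀ i, A i →ₐ[K] B)
  (hf : Pairwise fun i j => ∀ a b, Commute ((f i : A i →* B) a) ((f j : A j →* B) b))

/-- The universal property of the tensor product of algebras: pairwise commuting homomorphisms
out of the factors combine into one. -/
noncomputable def commutingLift : (⨂[K] i, A i) →ₐ[K] B :=
  PiTensorProduct.liftAlgHom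
    (MultilinearMap.mk' (MonoidHom.noncommPiCoprod (fun i => (f i : A i →* B)) hf)
      (fun m i a b => by
        simp only [noncommPiCoprod_update _ hf m i (_ + _), noncommPiCoprod_update _ hf m i a,
          noncommPiCoprod_update _ hf m i b, AlgHom.coe_toMonoidHom, map_add, add_mul])
      (fun m i c a => by
        simp only [noncommPiCoprod_update _ hf m i (_ • _), noncommPiCoprod_update _ hf m i a,
          AlgHom.coe_toMonoidHom, map_smul, smul_mul_assoc]))
    (map_one (MonoidHom.noncommPiCoprod _ hf)) (map_mul (MonoidHom.noncommPiCoprod _ hf))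

theorem commutingLift_tprod (a : ∀ i, A i) :
    commutingLift f hf (PiTensorProduct.tprod K a) =
      MonoidHom.noncommPiCoprod (fun i => (f i : A i →* B)) hf a :=
  PiTensorProduct.lift.tprod a

theorem commutingLift_singleAlgHom (i : ι) (a : A i) :
    commutingLift f hf (PiTensorProduct.singleAlgHom (R := K) i a) = f i a := by
  rw [PiTensorProduct.singleAlgHom_apply, commutingLift_tprod]
  exact MonoidHom.noncommPiCoprod_mulSingle _ i a

theorem commute_commutingLift {b : B} (h : ∀ i a, Commute (f i a) b) (t : ⨂[K] i, A i) :
    Commute (commutingLift f hf t) b := by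
  induction t using PiTensorProduct.induction_on with
  | smul_tprod c a =>
    rw [map_smul, commutingLift_tprod]
    exact (MonoidHom.commute_noncommPiCoprod _ (fun i a => (h i a).symm) a).symm.smul_left c
  | add t t' ht ht' =>
    rw [map_add]
    exact ht.add_left ht'

end CommutingLift

theorem monoidHom_pi_multiplicative_int_ext {τ M : Type*} [Finite τ] [DecidableEq τ] [Monoid M]
    {f g : (τ → Multiplicative ℤ) →* M}
    (h : ∀ j, f (Pi.mulSingle j (Multiplicative.ofAdd 1)) =
      g (Pi.mulSingle j (Multiplicative.ofAdd 1))) : f = g := by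
  refine MonoidHom.pi_ext fun j => DFunLike.congr_fun (?_ :
    f.comp (MonoidHom.mulSingle (fun _ => Multiplicative ℤ) j) = g.comp (MonoidHom.mulSingle _ j))
  exact MonoidHom.ext_mint (h j)

theorem QTorus.commute_map {K : Type u} [Field K] {n : ℕ} {q : Matrix (Fin n) (Fin n) Kˣ}
    {B : Type*} [Semiring B] [Algebra K B] (f : QTorus q →ₐ[K] B) {b : B}
    (h : ∀ i, Commute (f (QTorus.x q i)) b) (a : QTorus q) : Commute (f a) b := by
  suffices ⊤ ≤ (Subalgebra.centralizer K {b}).comap f from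
    ((Subalgebra.mem_centralizer_iff K).mp (this (Algebra.mem_top (x := a))) b rfl).symm
  rw [← QTorus.adjoin_x_eq_top, Algebra.adjoin_le_iff]
  rintro _ (⟨i, rfl⟩ | ⟨i, rfl⟩)
  · simpa [Set.mem_centralizer_iff] using (h i).symm.eq
  · have : Commute (↑(Units.map (f : QTorus q →* B) (QTorus.x q i))⁻¹) b :=
      Commute.units_inv_left (h i)
    simpa [Set.mem_centralizer_iff] using this.symm.eq

section Block

/-- The parameters of the direct sum of the rank two blocks with parameters `ε i`, `i : σ`, and
of a trivial part indexed by `τ`. -/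
def blockParam {G σ τ : Type*} [Group G] [DecidableEq σ] (ε : σ → G) :
    (σ × Fin 2) ⊕ τ → (σ × Fin 2) ⊕ τ → G
  | Sum.inl (i, a), Sum.inl (j, b) =>
    if i = j then (!![1, ε i; (ε i)⁻¹, 1] : Matrix (Fin 2) (Fin 2) G) a b else 1
  | _, _ => 1

theorem exists_of_blockParam_ne_one {G σ τ : Type*} [Group G] [DecidableEq σ] {ε : σ → G}
    {p p' : (σ × Fin 2) ⊕ τ} (h : blockParam ε p p' ≠ 1) :
    ∃ k, (p = Sum.inl (k, 0) ∧ p' = Sum.inl (k, 1)) ∨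
      (p = Sum.inl (k, 1) ∧ p' = Sum.inl (k, 0)) := by
  rcases p with ⟨i, a⟩ | i <;> rcases p' with ⟨j, b⟩ | j <;>
    simp only [blockParam, ne_eq, not_true] at h
  obtain rfl : i = j := by
    by_contra hij
    simp [hij] at h
  refine ⟨i, ?_⟩
  fin_cases a <;> fin_cases b <;> simp_all

theorem IsBlockDecomp.apply_eq_blockParam {ι G σ τ : Type*} [CommGroup G] [Fintype ι]
    [DecidableEq σ] {q : Matrix ι ι G} {ε : σ → G} {e : σ × Fin 2 → ι}
    (H : IsBlockDecomp q Finset.univ ε e) (hq : IsAlternating q) {f : ι ≃ (σ × Fin 2) ⊕ τ}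
    (hf : ∀ p, f (e p) = Sum.inl p) (a b : ι) : q a b = blockParam ε (f a) (f b) := by
  by_cases h : ∃ k, (a = e (k, 0) ∧ b = e (k, 1)) ∨ (a = e (k, 1) ∧ b = e (k, 0))
  · obtain ⟨k, ⟨rfl, rfl⟩ | ⟨rfl, rfl⟩⟩ := h
    · simp [hf, blockParam, H.apply_eq]
    · simp [hf, blockParam, hq.2 (e (k, 0)), H.apply_eq]
  · have h_left : q a b = 1 :=
      not_not.mp fun hab => h (H.eq_one a (Finset.mem_univ a) b (Finset.mem_univ b) hab)
    have h_right : blockParam ε (f a) (f b) = 1 := not_not.mp fun hab =>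
      h (by simpa only [← hf, f.injective.eq_iff] using exists_of_blockParam_ne_one hab)
    rw [h_left, h_right]

variable {K : Type u} [Field K] {σ : Type*} (ε : σ → Kˣ) (τ : Type*)

/-- The tensor product of the quantum tori of rank two with parameters `ε i`, `i : σ`, and of the
group algebra of the free abelian group on `τ`. -/
abbrev BlockTorus : Type _ :=
  (⨂[K] i, QTorus₂ (ε i)) ⊗[K] AddMonoidAlgebra K (τ → ℤ)

namespace BlockTorus

/-- The monomials of the commutative factor. -/
noncomputable def monomial : (τ → Multiplicative ℤ) →* BlockTorus ε τ :=
  (((Algebra.TensorProduct.includeRight :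
        AddMonoidAlgebra K (τ → ℤ) →ₐ[K] BlockTorus ε τ) :
        AddMonoidAlgebra K (τ → ℤ) →* BlockTorus ε τ).comp
      (AddMonoidAlgebra.of K (τ → ℤ))).comp
    (MulEquiv.funMultiplicative τ ℤ).symm.toMonoidHom

theorem monomial_apply (m : τ → Multiplicative ℤ) :
    monomial ε τ m = 1 ⊗ₜ AddMonoidAlgebra.of K (τ → ℤ)
      ((MulEquiv.funMultiplicative τ ℤ).symm m) := rfl

variable [DecidableEq σ]

/-- The inclusion of a rank two factor. -/
noncomputable def inc (i : σ) : QTorus₂ (ε i) →ₐ[K] BlockTorus ε τ :=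
  Algebra.TensorProduct.includeLeft.comp
    (PiTensorProduct.singleAlgHom (R := K) (A := fun i => QTorus₂ (ε i)) i)

theorem commute_inc_monomial (i : σ) (a : QTorus₂ (ε i)) (m : τ → Multiplicative ℤ) :
    Commute (inc ε τ i a) (monomial ε τ m) := by
  simp [inc, monomial_apply, Commute, SemiconjBy]

theorem commute_inc_inc {i j : σ} (hij : i ≠ j) (a : QTorus₂ (ε i)) (b : QTorus₂ (ε j)) :
    Commute (inc ε τ i a) (inc ε τ j b) :=
  (Commute.tprod (Pi.mulSingle_commute (f := fun i => QTorus₂ (ε i)) hij a b)).map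
    (Algebra.TensorProduct.includeLeft : (⨂[K] i, QTorus₂ (ε i)) →ₐ[K] BlockTorus ε τ)

section Lift

variable {ε τ} {B : Type*} [Semiring B] [Algebra K B] {w : (σ × Fin 2) ⊕ τ → Bˣ}
  (h : ∀ p p', SkewCommute (blockParam ε p p') (w p) (w p'))

/-- The map from a rank two factor induced by a family of units. -/
noncomputable def liftPair (i : σ) : QTorus₂ (ε i) →ₐ[K] B :=
  QTorus.lift (fun a => w (Sum.inl (i, a))) fun a b => by
    simpa [blockParam] using h (Sum.inl (i, a)) (Sum.inl (i, b))

theorem pairwise_commute_liftPair : Pairwise fun i j => ∀ a b,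
    Commute ((liftPair h i : QTorus₂ (ε i) →* B) a) ((liftPair h j : QTorus₂ (ε j) →* B) b) := by
  intro i j hij a b
  refine QTorus.commute_map _ (fun k => (QTorus.commute_map _ (fun l => ?_) b).symm) a
  have h_comm : Commute (w (Sum.inl (j, l))) (w (Sum.inl (i, k))) := by
    simpa [blockParam, hij.symm, skewCommute_one_iff] using h (Sum.inl (j, l)) (Sum.inl (i, k))
  simpa [liftPair] using h_comm.map (Units.coeHom B)

/-- The map from the monomials induced by a family of units. -/
noncomputable def liftMonomial [Fintype τ] : (τ → Multiplicative ℤ) →* B :=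
  MonoidHom.noncommPiCoprod
    (fun j => (Units.coeHom B).comp (zpowersHom Bˣ (w (Sum.inr j)))) fun i j _ _ _ =>
      ((skewCommute_one_iff.mp (h (Sum.inr i) (Sum.inr j))).zpow_zpow _ _).map (Units.coeHom B)

theorem commute_liftPair_liftMonomial [Fintype τ] (i : σ) (a : QTorus₂ (ε i))
    (m : τ → Multiplicative ℤ) : Commute (liftPair h i a) (liftMonomial h m) := by
  refine QTorus.commute_map _ (fun k => MonoidHom.commute_noncommPiCoprod _ (fun j c => ?_) _) a
  have h_comm := skewCommute_one_iff.mp (h (Sum.inl (i, k)) (Sum.inr j))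
  simpa [liftPair] using (h_comm.zpow_right c.toAdd).map (Units.coeHom B)

variable [Fintype σ] [Fintype τ]

/-- The universal property of the tensor product of quantum tori of rank two and a group
algebra. -/
noncomputable def lift : BlockTorus ε τ →ₐ[K] B :=
  Algebra.TensorProduct.lift
    (commutingLift (liftPair h) (pairwise_commute_liftPair h))
    (AddMonoidAlgebra.lift K B (τ → ℤ)
      ((liftMonomial h).comp (MulEquiv.funMultiplicative τ ℤ).toMonoidHom))
    (by
      intro t b
      rw [AddMonoidAlgebra.lift_apply]
      exact Commute.sum_right _ _ _ fun m _ => (commute_commutingLift _ _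
        (fun i a => commute_liftPair_liftMonomial h i a _) t).smul_right _)

theorem lift_inc (i : σ) (a : QTorus₂ (ε i)) : lift h (inc ε τ i a) = liftPair h i a := by
  rw [lift, inc, AlgHom.comp_apply, Algebra.TensorProduct.includeLeft_apply,
    Algebra.TensorProduct.lift_tmul, map_one, mul_one, commutingLift_singleAlgHom]

theorem lift_monomial (m : τ → Multiplicative ℤ) :
    lift h (monomial ε τ m) = liftMonomial h m := by
  rw [lift, monomial_apply, Algebra.TensorProduct.lift_tmul, map_one, one_mul,
    AddMonoidAlgebra.lift_of, MonoidHom.comp_apply]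
  exact congrArg _ (MulEquiv.apply_symm_apply _ m)

end Lift

variable [DecidableEq τ]

/-- The generators of the tensor product. -/
noncomputable def x : (σ × Fin 2) ⊕ τ → (BlockTorus ε τ)ˣ
  | Sum.inl (i, a) => Units.map (inc ε τ i : QTorus₂ (ε i) →* BlockTorus ε τ) (QTorus.x _ a)
  | Sum.inr j => Units.map (monomial ε τ) (toUnits (Pi.mulSingle j (Multiplicative.ofAdd 1)))

theorem skewCommute_x (p p' : (σ × Fin 2) ⊕ τ) :
    SkewCommute (blockParam ε p p') (x ε τ p) (x ε τ p') := by
  rcases p with ⟨i, a⟩ | i <;> rcases p' with ⟨j, b⟩ | j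
  · obtain rfl | hij := eq_or_ne i j
    · simp only [blockParam, if_true]
      exact (QTorus.skewCommute_x _ a b).map (inc ε τ i)
    · simp only [blockParam, hij, if_false, skewCommute_one_iff]
      exact Units.ext (commute_inc_inc ε τ hij _ _).eq
  · exact skewCommute_one_iff.mpr (Units.ext (commute_inc_monomial ε τ i _ _).eq)
  · exact skewCommute_one_iff.mpr (Units.ext (commute_inc_monomial ε τ j _ _).symm.eq)
  · exact skewCommute_one_iff.mpr ((Commute.all _ _).map _)

variable {ε τ} {B : Type*} [Semiring B] [Algebra K B]

theorem algHom_ext [Finite σ] [Finite τ] {f g : BlockTorus ε τ →ₐ[K] B}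
    (h : ∀ p, f (x ε τ p) = g (x ε τ p)) : f = g := by
  refine Algebra.TensorProduct.ext ?_ ?_
  · refine PiTensorProduct.algHom_ext fun i => ?_
    exact QTorus.algHom_ext (f := f.comp (inc ε τ i)) (g := g.comp (inc ε τ i))
      fun a => h (Sum.inl (i, a))
  · have h_monomial : (f : _ →* B).comp (monomial ε τ) = (g : _ →* B).comp (monomial ε τ) :=
      monoidHom_pi_multiplicative_int_ext fun j => h (Sum.inr j)
    refine (AddMonoidAlgebra.lift K B (τ → ℤ)).symm.injective (MonoidHom.ext fun m => ?_)
    exact DFunLike.congr_fun h_monomial (MulEquiv.funMultiplicative τ ℤ m)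

theorem lift_x [Fintype σ] [Fintype τ] {w : (σ × Fin 2) ⊕ τ → Bˣ}
    (h : ∀ p p', SkewCommute (blockParam ε p p') (w p) (w p')) (p : (σ × Fin 2) ⊕ τ) :
    lift h (x ε τ p) = w p := by
  rcases p with ⟨i, a⟩ | j
  · exact (lift_inc h i _).trans (QTorus.lift_x _ _ a)
  · refine (lift_monomial h _).trans ?_
    exact (MonoidHom.noncommPiCoprod_mulSingle (N := fun _ => Multiplicative ℤ) _ j
      (Multiplicative.ofAdd 1)).trans (by simp)

end BlockTorus

variable {ε τ}

theorem nonempty_algEquiv_blockTorus [DecidableEq σ] {n : ℕ} (e : Fin n ≃ (σ × Fin 2) ⊕ τ)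
    {q : Matrix (Fin n) (Fin n) Kˣ} (hq : ∀ a b, q a b = blockParam ε (e a) (e b)) :
    Nonempty (QTorus q ≃ₐ[K] BlockTorus ε τ) := by
  classical
  have := Finite.of_equiv _ e
  have : Finite (σ × Fin 2) := Finite.sum_left τ
  have : Finite τ := Finite.sum_right (σ × Fin 2)
  have := Fintype.ofFinite τ
  have := @Fintype.ofFinite σ (Finite.prod_left (Fin 2))
  have h_block (a b) : SkewCommute (q a b) (BlockTorus.x ε τ (e a)) (BlockTorus.x ε τ (e b)) :=
    hq a b ▸ BlockTorus.skewCommute_x ε τ _ _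
  have h_torus (p p') : SkewCommute (blockParam ε p p') (QTorus.x q (e.symm p))
      (QTorus.x q (e.symm p')) := by
    simpa [hq] using QTorus.skewCommute_x q (e.symm p) (e.symm p')
  refine ⟨AlgEquiv.ofAlgHom (QTorus.lift _ h_block) (BlockTorus.lift h_torus)
    (BlockTorus.algHom_ext fun p => ?_) (QTorus.algHom_ext fun a => ?_)⟩
  · simp [BlockTorus.lift_x]
  · simp [BlockTorus.lift_x]

end Block

section NormalForm

theorem exists_equiv_sum_extending {α ι : Type*} [Fintype α] [Fintype ι] {r : ℕ} {e : α → ι}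
    (he : Function.Injective e) (hr : Fintype.card ι - Fintype.card α = r) :
    ∃ f : ι ≃ α ⊕ Fin r, ∀ p, f (e p) = Sum.inl p := by
  classical
  have hcard : Fintype.card ((Set.range e)ᶜ : Set ι) = r := by
    rw [Fintype.card_compl_set, Set.card_range_of_injective he, hr]
  refine ⟨(Equiv.Set.sumCompl (Set.range e)).symm.trans
    (Equiv.sumCongr (Equiv.ofInjective e he).symm (Fintype.equivFinOfCardEq hcard)), fun p => ?_⟩
  simp [Equiv.Set.sumCompl_symm_apply_of_mem (Set.mem_range_self p)]

variable {K : Type u} [Field K] {n : ℕ} {q : Matrix (Fin n) (Fin n) Kˣ}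

theorem paramGroup_finite (htors : IsMulTorsion (paramGroup q)) : Finite (paramGroup q) := by
  have hfin : {a | ∃ i j, q i j = a}.Finite := by
    refine (Set.finite_range fun p : Fin n × Fin n => q p.1 p.2).subset ?_
    rintro _ ⟨i, j, rfl⟩
    exact ⟨(i, j), rfl⟩
  have : Group.FG (paramGroup q) :=
    (Group.fg_iff_subgroup_fg _).mpr ⟨hfin.toFinset, by simp [paramGroup]⟩
  exact CommGroup.finite_of_fg_isMulTorsion _ htors

theorem mem_paramGroup (i j : Fin n) : q i j ∈ paramGroup q :=
  Subgroup.subset_closure ⟨i, j, rfl⟩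

theorem exists_zpowers_eq_paramGroup [Finite (paramGroup q)] :
    ∃ g : Kˣ, Subgroup.zpowers g = paramGroup q :=
  (Subgroup.isCyclic_iff_exists_zpowers_eq_top _).mp (isCyclic_subgroup_units (paramGroup q))

theorem IsExponentChain.eq_one_of_reach {q' : Matrix (Fin n) (Fin n) Kˣ} {g : Kˣ} {N s z : ℕ}
    {h : Fin s → ℕ} {e : Fin s × Fin 2 → Fin n} (hh : IsExponentChain g N h z)
    (hg : Subgroup.zpowers g ≤ paramGroup q) (hq : IsAlternating q)
    (hr : Reach Finset.univ q q')
    (H : IsBlockDecomp q' Finset.univ (fun k => g ^ normalExp N h z k) e) {i : Fin s}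
    (hi : i.val = 0) : h i = 1 := by
  have h_block (k : Fin s) : g ^ normalExp N h z k ∈ Subgroup.zpowers (g ^ h i) := by
    refine zpowers_pow_le_of_dvd g (hh.chain i k (Fin.le_def.mpr (hi ▸ k.val.zero_le))) ?_
    exact hh.zpowers_eq k ▸ Subgroup.mem_zpowers _
  have h_entry := (hr.symm hq).mem_subgroup (H.mem_zpowers (hr.isAlternating hq) h_block)
  have h_group : paramGroup q ≤ Subgroup.zpowers (g ^ h i) := by
    rw [paramGroup, Subgroup.closure_le]
    rintro _ ⟨a, b, rfl⟩
    exact h_entry a (Finset.mem_univ a) b (Finset.mem_univ b)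
  refine Nat.dvd_one.mp (dvd_of_pow_mem_zpowers (hh.dvd i) (h_group (hg ?_)))
  exact (pow_one g).symm ▸ Subgroup.mem_zpowers g

theorem exists_isNormalForm [Finite (paramGroup q)] (hq : IsMulAntisymm q) {g : Kˣ}
    (hg : Subgroup.zpowers g = paramGroup q) :
    ∃ (s : ℕ) (h : Fin s → ℕ) (z : ℕ), IsNormalForm q g s h z := by
  have hcard : Nat.card (paramGroup q) = orderOf g := by rw [← hg, Nat.card_zpowers]
  have hfin : IsOfFinOrder g := orderOf_pos_iff.mp (hcard ▸ Nat.card_pos)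
  obtain ⟨q', s, h, z, e, hr, hh, H⟩ := exists_reach_isBlockDecomp hfin Finset.univ hq
    fun a _ b _ => hg ▸ mem_paramGroup a b
  rw [Finset.card_univ, Fintype.card_fin] at hh H
  obtain ⟨f, hf⟩ := exists_equiv_sum_extending (r := n - 2 * s) H.injective (by simp [mul_comm])
  obtain ⟨φ⟩ := hr.nonempty_algEquiv hq
  obtain ⟨ψ⟩ := nonempty_algEquiv_blockTorus f (H.apply_eq_blockParam (hr.isAlternating hq) hf)
  exact ⟨s, h, z, {
    two_mul_le := by simpa [mul_comm] using Fintype.card_le_of_injective e H.injective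
    dvd_card := hcard ▸ hh.dvd
    lt_card := hcard ▸ hh.lt
    first := fun i hi => hh.eq_one_of_reach hg.le hq hr H hi
    chain := hh.chain
    order_eq := fun i => by rw [← Nat.card_zpowers, hh.zpowers_eq, Nat.card_zpowers]
    iso := ⟨φ.trans ψ⟩ }⟩

end NormalForm

theorem finrank_iSup_of_iSupIndep {K V ι : Type*} [Field K] [AddCommGroup V] [Module K V]
    [Fintype ι] {p : ι → Submodule K V} [∀ i, Module.Finite K (p i)] (hp : iSupIndep p) :
    Module.finrank K ↥(⨆ i, p i) = ∑ i, Module.finrank K (p i) := by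
  classical
  rw [Submodule.iSup_eq_range_dfinsupp_lsum,
    LinearMap.finrank_range_of_inj hp.dfinsupp_lsum_injective]
  exact Module.finrank_directSum K fun i => p i

section IterateSpan

variable {R V : Type*} [CommRing R] [AddCommGroup V] [Module R V]

theorem pow_apply_skew {S T : Module.End R V} {c : R} (h : ∀ v, S (T v) = c • T (S v)) (a : ℕ)
    (v : V) : S ((T ^ a) v) = c ^ a • (T ^ a) (S v) := by
  induction a generalizing v with
  | zero => simp
  | succ a ih =>
    rw [pow_succ, Module.End.mul_apply, Module.End.mul_apply, ih, h, map_smul, smul_smul, pow_succ]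

/-- The sum of the images of `W` under `1, T, …, T ^ (k - 1)`. Irreducible modules over quantum
spaces are built from smaller subspaces by this operation. -/
def iterateSpan (T : Module.End R V) (k : ℕ) (W : Submodule R V) : Submodule R V :=
  ⨆ a : Fin k, W.map (T ^ (a : ℕ))

variable {S T : Module.End R V} {k : ℕ} {W U : Submodule R V}

theorem pow_apply_mem_iterateSpan {a : ℕ} (ha : a < k) {w : V} (hw : w ∈ W) :
    (T ^ a) w ∈ iterateSpan T k W :=
  le_iSup (fun a : Fin k => W.map (T ^ (a : ℕ))) ⟨a, ha⟩ ⟨w, hw, rfl⟩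

theorem le_iterateSpan (hk : 0 < k) : W ≤ iterateSpan T k W :=
  fun _ hw => pow_apply_mem_iterateSpan (T := T) hk hw

theorem iterateSpan_le (h : ∀ a < k, ∀ w ∈ W, (T ^ a) w ∈ U) : iterateSpan T k W ≤ U := by
  refine iSup_le fun a => ?_
  rintro _ ⟨w, hw, rfl⟩
  exact h a a.2 w hw

theorem fg_iterateSpan (hW : W.FG) : (iterateSpan T k W).FG :=
  Submodule.fg_iSup _ fun _ => hW.map _

theorem apply_mem_iterateSpan (hk : 0 < k) (hW : ∀ w ∈ W, (T ^ k) w ∈ W) :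
    ∀ w ∈ iterateSpan T k W, T w ∈ iterateSpan T k W := by
  refine iterateSpan_le (U := (iterateSpan T k W).comap T) fun a ha w hw => ?_
  rw [Submodule.mem_comap, ← Module.End.mul_apply, ← pow_succ']
  obtain h | rfl : a + 1 < k ∨ a + 1 = k := by omega
  · exact pow_apply_mem_iterateSpan h hw
  · exact le_iterateSpan hk (hW w hw)

theorem apply_mem_iterateSpan_of_skew {c : R} (h : ∀ v, S (T v) = c • T (S v))
    (hW : ∀ w ∈ W, S w ∈ W) : ∀ w ∈ iterateSpan T k W, S w ∈ iterateSpan T k W := by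
  refine iterateSpan_le (U := (iterateSpan T k W).comap S) fun a ha w hw => ?_
  rw [Submodule.mem_comap, pow_apply_skew h]
  exact Submodule.smul_mem _ _ (pow_apply_mem_iterateSpan ha (hW w hw))

theorem pow_apply_mem_eigenspace {c μ : R} (h : ∀ v, S (T v) = c • T (S v)) {w : V}
    (hw : S w = μ • w) (a : ℕ) : (T ^ a) w ∈ Module.End.eigenspace S (c ^ a * μ) := by
  rw [Module.End.mem_eigenspace_iff, pow_apply_skew h, hw, map_smul, smul_smul]

end IterateSpan

theorem finrank_iterateSpan {K V : Type*} [Field K] [AddCommGroup V] [Module K V]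
    {S T : Module.End K V} {W : Submodule K V} [Module.Finite K W] {ε μ : Kˣ}
    (h : ∀ v, S (T v) = (ε : K) • T (S v)) (hT : Function.Injective T)
    (hW : ∀ w ∈ W, S w = (μ : K) • w) :
    Module.finrank K (iterateSpan T (orderOf ε) W) = orderOf ε * Module.finrank K W := by
  have h_inj (a : ℕ) : Function.Injective (T ^ a) := by
    rw [Module.End.coe_pow]
    exact hT.iterate a
  have h_eigenvalues : Function.Injective fun a : Fin (orderOf ε) => (ε : K) ^ (a : ℕ) * μ := by
    intro a b hab
    have h_pow : ε ^ (a : ℕ) = ε ^ (b : ℕ) :=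
      Units.ext (by simpa using mul_right_cancel₀ μ.ne_zero hab)
    exact Fin.ext (pow_injOn_Iio_orderOf a.2 b.2 h_pow)
  have h_indep : iSupIndep fun a : Fin (orderOf ε) => W.map (T ^ (a : ℕ)) := by
    refine ((Module.End.eigenspaces_iSupIndep S).comp h_eigenvalues).mono fun a => ?_
    rintro _ ⟨w, hw, rfl⟩
    exact pow_apply_mem_eigenspace h (hW w hw) a
  rw [iterateSpan, finrank_iSup_of_iSupIndep h_indep]
  simp [← (Submodule.equivMapOfInjective _ (h_inj _) W).finrank_eq]

section Zariski

variable {R V : Type*} [CommRing R] [AddCommGroup V] [Module R V]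

theorem isField_of_forall_smul_surjective [Nontrivial V] [Module.Finite R V] [FaithfulSMul R V]
    (h : ∀ r : R, r ≠ 0 → Function.Surjective fun v : V => r • v) : IsField R := by
  have : Nontrivial R := Module.nontrivial R V
  refine ⟨exists_pair_ne R, mul_comm, fun {r} hr => ?_⟩
  -- Nakayama: `V = r V` yields an element of `1 + (r)` that annihilates `V`, hence is zero
  obtain ⟨t, ht, ht_smul⟩ := Submodule.exists_sub_one_mem_and_smul_eq_zero_of_fg_of_le_smul
    (Ideal.span {r}) (⊤ : Submodule R V) Module.Finite.fg_top (fun v _ => by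
      obtain ⟨w, rfl⟩ := h r hr v
      exact Submodule.smul_mem_smul (Ideal.mem_span_singleton_self r) Submodule.mem_top)
  have ht_zero : t = 0 := FaithfulSMul.eq_of_smul_eq_smul (α := V) fun v => by
    rw [ht_smul v Submodule.mem_top, zero_smul]
  rw [ht_zero, zero_sub, neg_mem_iff, Ideal.mem_span_singleton] at ht
  obtain ⟨c, hc⟩ := ht
  exact ⟨c, hc.symm⟩

theorem exists_fg_invariant_submodule {ι : Type*} {T : ι → Module.End R V}
    {c : ι → ι → R} (hT : ∀ i j v, T i (T j v) = c i j • T j (T i v)) {m : ℕ} (hm : 0 < m)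
    {d : ι → R} (hd : ∀ i v, (T i ^ m) v = d i • v) (v : V) (F : Finset ι) :
    ∃ W : Submodule R V, W.FG ∧ v ∈ W ∧ ∀ i ∈ F, ∀ w ∈ W, T i w ∈ W := by
  classical
  induction F using Finset.induction_on with
  | empty => exact ⟨R ∙ v, Submodule.fg_span_singleton v, Submodule.mem_span_singleton_self v,
      by simp⟩
  | insert i F hi ih =>
    obtain ⟨W, h_fg, hv, hW⟩ := ih
    refine ⟨iterateSpan (T i) m W, fg_iterateSpan h_fg, le_iterateSpan hm hv, fun j hj => ?_⟩
    obtain rfl | hj := Finset.mem_insert.mp hj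
    · exact apply_mem_iterateSpan hm fun w hw => hd j w ▸ W.smul_mem _ hw
    · exact apply_mem_iterateSpan_of_skew (hT j i) (hW j hj)

end Zariski

section Irreducible

variable {K V ι : Type*} [Field K] [AddCommGroup V] [Module K V]

/-- A family of endomorphisms of a nonzero space without proper nonzero invariant subspaces. For
the action of generators of an algebra this is simplicity of the module. -/
structure IsIrreducibleFamily (T : ι → Module.End K V) : Prop where
  nontrivial : Nontrivial V
  eq_bot_or_eq_top : ∀ W : Submodule K V, (∀ i, ∀ v ∈ W, T i v ∈ W) → W = ⊥ ∨ W = ⊤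

namespace IsIrreducibleFamily

variable {T : ι → Module.End K V}

theorem eq_top (hT : IsIrreducibleFamily T) {W : Submodule K V} (hW : ∀ i, ∀ v ∈ W, T i v ∈ W)
    {v : V} (hv : v ≠ 0) (hvW : v ∈ W) : W = ⊤ :=
  (hT.eq_bot_or_eq_top W hW).resolve_left fun h => hv (by simpa [h] using hvW)

theorem comp_equiv {κ : Type*} (hT : IsIrreducibleFamily T) (e : κ ≃ ι) :
    IsIrreducibleFamily fun k => T (e k) :=
  ⟨hT.nontrivial, fun W hW => hT.eq_bot_or_eq_top W fun i => by simpa using hW (e.symm i)⟩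

theorem surjective_of_range (hT : IsIrreducibleFamily T) {U : Type*} [AddCommGroup U] [Module K U]
    {f : U →ₗ[K] V} {u : U} (hu : f u ≠ 0) (h : ∀ i u, T i (f u) ∈ LinearMap.range f) :
    Function.Surjective f := by
  refine LinearMap.range_eq_top.mp (hT.eq_top ?_ hu ⟨u, rfl⟩)
  rintro i _ ⟨u, rfl⟩
  exact h i u

theorem bijective_of_range [Module.Finite K V] (hT : IsIrreducibleFamily T) {U : Type*}
    [AddCommGroup U] [Module K U] [Module.Finite K U] {f : U →ₗ[K] V} {u : U} (hu : f u ≠ 0)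
    (h : ∀ i u, T i (f u) ∈ LinearMap.range f) (h_rank : Module.finrank K U = Module.finrank K V) :
    Function.Bijective f :=
  have h_surj := hT.surjective_of_range hu h
  ⟨(LinearMap.injective_iff_surjective_of_finrank_eq_finrank h_rank).mpr h_surj, h_surj⟩

theorem exists_linearEquiv_of_prodMap [Module.Finite K V] (hT : IsIrreducibleFamily T) {V' : Type*}
    [AddCommGroup V'] [Module K V'] [Module.Finite K V'] {T' : ι → Module.End K V'}
    (hT' : IsIrreducibleFamily T') {W : Submodule K (V × V')}
    (hW : ∀ i, ∀ w ∈ W, (T i).prodMap (T' i) w ∈ W) {w : V × V'} (hw : w ∈ W) (h₁ : w.1 ≠ 0)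
    (h₂ : w.2 ≠ 0) (h_rank₁ : Module.finrank K W = Module.finrank K V)
    (h_rank₂ : Module.finrank K W = Module.finrank K V') :
    ∃ e : V ≃ₗ[K] V', ∀ i v, e (T i v) = T' i (e v) := by
  -- `W` is the graph of the isomorphism
  let e₁ := LinearEquiv.ofBijective (LinearMap.fst K V V' ∘ₗ W.subtype)
    (hT.bijective_of_range (u := ⟨w, hw⟩) h₁ (fun i u => ⟨⟨_, hW i u u.2⟩, rfl⟩) h_rank₁)
  let e₂ := LinearEquiv.ofBijective (LinearMap.snd K V V' ∘ₗ W.subtype)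
    (hT'.bijective_of_range (u := ⟨w, hw⟩) h₂ (fun i u => ⟨⟨_, hW i u u.2⟩, rfl⟩) h_rank₂)
  refine ⟨e₁.symm.trans e₂, fun i v => ?_⟩
  obtain ⟨u, rfl⟩ := e₁.surjective v
  have h_fst : T i (e₁ u) = e₁ ⟨_, hW i u u.2⟩ := rfl
  have h_snd : T' i (e₂ u) = e₂ ⟨_, hW i u u.2⟩ := rfl
  rw [h_fst, LinearEquiv.trans_apply, LinearEquiv.trans_apply, LinearEquiv.symm_apply_apply,
    LinearEquiv.symm_apply_apply, h_snd]

theorem eq_smul_of_commute [IsAlgClosed K] [Module.Finite K V] (hT : IsIrreducibleFamily T)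
    {f : Module.End K V} (h : ∀ i v, T i (f v) = f (T i v)) : ∃ c : K, ∀ v, f v = c • v := by
  have := hT.nontrivial
  obtain ⟨c, hc⟩ := Module.End.exists_eigenvalue f
  obtain ⟨v, hv⟩ := hc.exists_hasEigenvector
  have h_top : Module.End.eigenspace f c = ⊤ := by
    refine hT.eq_top (fun i w hw => ?_) hv.2 hv.1
    rw [Module.End.mem_eigenspace_iff] at hw ⊢
    rw [← h, hw, map_smul]
  exact ⟨c, fun w => Module.End.mem_eigenspace_iff.mp (h_top ▸ Submodule.mem_top)⟩

theorem module_finite_of_central (hT : IsIrreducibleFamily T) [Finite ι] {R : Type*} [CommRing R]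
    [Algebra K R] [Algebra.FiniteType K R] [Module R V] [IsScalarTower K R V] [FaithfulSMul R V]
    {c : ι → ι → K} (hc : ∀ i j v, T i (T j v) = c i j • T j (T i v)) {m : ℕ} (hm : 0 < m)
    {d : ι → R} (hd : ∀ i v, (T i ^ m) v = d i • v) (hR : ∀ i (r : R) v, T i (r • v) = r • T i v) :
    Module.Finite K V := by
  classical
  have := Fintype.ofFinite ι
  have := hT.nontrivial
  obtain ⟨v, hv⟩ := exists_ne (0 : V)
  let TR (i : ι) : Module.End R V := { T i with map_smul' := hR i }
  have hTR_pow (i : ι) (a : ℕ) (v : V) : (TR i ^ a) v = (T i ^ a) v := by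
    simp only [Module.End.pow_apply]
    rfl
  have hV : Module.Finite R V := by
    obtain ⟨W, h_fg, hvW, hW⟩ := exists_fg_invariant_submodule (T := TR)
      (c := fun i j => algebraMap K R (c i j)) (d := d)
      (fun i j v => (hc i j v).trans (algebraMap_smul R _ _).symm) hm
      (fun i v => (hTR_pow i m v).trans (hd i v)) v Finset.univ
    have hW_top : W.restrictScalars K = ⊤ :=
      hT.eq_top (fun i w hw => hW i (Finset.mem_univ i) w hw) hv hvW
    exact ⟨(Submodule.restrictScalars_eq_top_iff K R V).mp hW_top ▸ h_fg⟩
  have hR_field : IsField R := by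
    refine isField_of_forall_smul_surjective (V := V) fun r hr => ?_
    obtain ⟨u, hu⟩ : ∃ u : V, r • u ≠ 0 := by
      by_contra! h
      exact hr (FaithfulSMul.eq_of_smul_eq_smul (α := V) fun v => by rw [h, zero_smul])
    exact hT.surjective_of_range (f := Algebra.lsmul K K V r) hu fun i v => ⟨T i v, (hR i r v).symm⟩
  let _ := hR_field.toField
  -- Zariski's lemma
  have := finite_of_finite_type_of_isJacobsonRing K R
  exact Module.Finite.trans R V

open scoped IsMulCommutative in
theorem module_finite [Finite ι] (hT : IsIrreducibleFamily T) {c : ι → ι → K}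
    (hc : ∀ i j v, T i (T j v) = c i j • T j (T i v)) {m : ℕ} (hm : 0 < m)
    (hcm : ∀ i j, c i j ^ m = 1) : Module.Finite K V := by
  have h_commute (i j : ι) : Commute (T i) (T j ^ m) := LinearMap.ext fun v => by
    simpa [hcm] using pow_apply_skew (hc i j) m v
  have h_comm : ∀ a ∈ Set.range fun i => T i ^ m, ∀ b ∈ Set.range fun i => T i ^ m,
      a * b = b * a := by
    rintro _ ⟨i, rfl⟩ _ ⟨j, rfl⟩
    exact (h_commute i j).pow_left m
  let R := Algebra.adjoin K (Set.range fun i => T i ^ m)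
  have : IsMulCommutative R := Algebra.isMulCommutative_adjoin K h_comm
  have : Algebra.FiniteType K R :=
    R.fg_iff_finiteType.mp (Subalgebra.fg_def.mpr ⟨_, Set.finite_range _, rfl⟩)
  refine hT.module_finite_of_central (R := R) hc hm
    (d := fun i => ⟨T i ^ m, Algebra.subset_adjoin ⟨i, rfl⟩⟩) (fun _ _ => rfl) fun i r v => ?_
  have hR : R ≤ Subalgebra.centralizer K {T i} := by
    refine Algebra.adjoin_le ?_
    rintro _ ⟨j, rfl⟩ _ rfl
    exact h_commute i j
  exact LinearMap.congr_fun (hR r.2 _ rfl) v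

end IsIrreducibleFamily

end Irreducible

section TorusRep

variable {K V V' ι : Type*} [Field K] [AddCommGroup V] [Module K V] [AddCommGroup V'] [Module K V']

/-- The family `T` is the action of the generators in a right representation of the quantum torus
with parameters `q`; right multiplication by `x i * x j` is `T j ∘ T i`. Bijectivity is only
required in the form of injectivity, the two being equivalent in finite dimension. -/
structure IsTorusRep (q : ι → ι → Kˣ) (T : ι → Module.End K V) : Prop where
  skew : ∀ i j v, T j (T i v) = (q i j : K) • T i (T j v)
  injective : ∀ i, Function.Injective (T i)

namespace IsTorusRep

variable {q : ι → ι → Kˣ} {T : ι → Module.End K V} {T' : ι → Module.End K V'}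

theorem prodMap (hT : IsTorusRep q T) (hT' : IsTorusRep q T') :
    IsTorusRep q fun i => (T i).prodMap (T' i) :=
  ⟨fun i j v => Prod.ext (hT.skew i j v.1) (hT'.skew i j v.2),
    fun i => (hT.injective i).prodMap (hT'.injective i)⟩

theorem pow_injective (hT : IsTorusRep q T) (i : ι) (a : ℕ) : Function.Injective (T i ^ a) := by
  rw [Module.End.coe_pow]
  exact (hT.injective i).iterate a

end IsTorusRep

end TorusRep

section Block

variable {K σ τ : Type*} [Field K] {ε : σ → Kˣ}

section BlockParam

variable [DecidableEq σ]

theorem blockParam_zero_one (i : σ) :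
    blockParam (τ := τ) ε (Sum.inl (i, 0)) (Sum.inl (i, 1)) = ε i := by
  simp [blockParam]

theorem blockParam_inl_of_ne {i j : σ} (h : i ≠ j) (a b : Fin 2) :
    blockParam (τ := τ) ε (Sum.inl (i, a)) (Sum.inl (j, b)) = 1 := by
  simp [blockParam, h]

theorem blockParam_one_one (i j : σ) :
    blockParam (τ := τ) ε (Sum.inl (i, 1)) (Sum.inl (j, 1)) = 1 := by
  obtain rfl | h := eq_or_ne i j
  · simp [blockParam]
  · exact blockParam_inl_of_ne h 1 1

end BlockParam

/-- The exponents of the central powers of the generators. -/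
noncomputable def centralExp (ε : σ → Kˣ) : (σ × Fin 2) ⊕ τ → ℕ :=
  Sum.elim (fun p => orderOf (ε p.1)) fun _ => 1

theorem blockParam_pow_centralExp [DecidableEq σ] (p p' : (σ × Fin 2) ⊕ τ) :
    blockParam ε p p' ^ centralExp ε p = 1 := by
  by_cases h : blockParam ε p p' = 1
  · rw [h, one_pow]
  · obtain ⟨k, ⟨rfl, rfl⟩ | ⟨rfl, rfl⟩⟩ := exists_of_blockParam_ne_one h <;>
      simp [blockParam, centralExp, pow_orderOf_eq_one]

theorem exists_units_pow_eq [IsAlgClosed K] {k : ℕ} (hk : 0 < k) (c : Kˣ) :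
    ∃ z : Kˣ, z ^ k = c := by
  obtain ⟨z, hz⟩ := IsAlgClosed.exists_pow_nat_eq (c : K) hk
  have hz_zero : z ≠ 0 := by
    rintro rfl
    exact c.ne_zero (hz.symm.trans (zero_pow hk.ne'))
  exact ⟨Units.mk0 z hz_zero, Units.ext hz⟩

theorem exists_pow_mul_eq_of_pow_eq {ε μ : Kˣ} {l : K} (hε : 0 < orderOf ε)
    (h : l ^ orderOf ε = (μ : K) ^ orderOf ε) : ∃ a : ℕ, (ε : K) ^ a * l = μ := by
  have hl : l ≠ 0 := by
    rintro rfl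
    exact pow_ne_zero _ μ.ne_zero (h.symm.trans (zero_pow hε.ne'))
  have : NeZero (orderOf ε) := ⟨hε.ne'⟩
  obtain ⟨a, -, ha⟩ := (IsPrimitiveRoot.coe_units_iff.mpr
    (IsPrimitiveRoot.orderOf ε)).eq_pow_of_pow_eq_one (ξ := (μ : K) / l) (by
      rw [div_pow, h, div_self (pow_ne_zero _ μ.ne_zero)])
  exact ⟨a, by rw [ha, div_mul_cancel₀ _ hl]⟩

variable {V V' : Type*} [AddCommGroup V] [Module K V] [AddCommGroup V'] [Module K V']
  {T : (σ × Fin 2) ⊕ τ → Module.End K V} {T' : (σ × Fin 2) ⊕ τ → Module.End K V'}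

theorem exists_eigenvector_mem [IsAlgClosed K] [Module.Finite K V] {f : Module.End K V}
    {E : Submodule K V} (hf : ∀ w ∈ E, f w ∈ E) {v : V} (hvE : v ∈ E) (hv : v ≠ 0) :
    ∃ w ∈ E, ∃ l, f.HasEigenvector l w := by
  have : Nontrivial E := ⟨⟨v, hvE⟩, 0, fun h => hv (congrArg Subtype.val h)⟩
  obtain ⟨l, hl⟩ := Module.End.exists_eigenvalue (f.restrict hf)
  obtain ⟨w, hw⟩ := hl.exists_hasEigenvector
  exact ⟨w, w.2, l, Module.End.hasEigenvector_iff.mpr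
    ⟨Module.End.mem_eigenspace_iff.mpr (congrArg Subtype.val hw.apply_eq_smul),
      fun h => hw.2 (Subtype.ext h)⟩⟩

/-- The central powers of the generators of a block torus act as the scalars `θ`; these are the
values at the generators of the centre of the central character of a representation. -/
def HasCentralChar (ε : σ → Kˣ) (T : (σ × Fin 2) ⊕ τ → Module.End K V)
    (θ : (σ × Fin 2) ⊕ τ → Kˣ) : Prop :=
  ∀ p v, (T p ^ centralExp ε p) v = (θ p : K) • v

theorem HasCentralChar.prodMap {θ : (σ × Fin 2) ⊕ τ → Kˣ} (hT : HasCentralChar ε T θ)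
    (hT' : HasCentralChar ε T' θ) : HasCentralChar ε (fun p => (T p).prodMap (T' p)) θ := by
  intro p v
  have h_pow : (T p).prodMap (T' p) ^ centralExp ε p =
      (T p ^ centralExp ε p).prodMap (T' p ^ centralExp ε p) :=
    (map_pow (LinearMap.prodMapAlgHom K V V') (T p, T' p) _).symm
  rw [h_pow]
  exact Prod.ext (hT p v.1) (hT' p v.2)

namespace IsTorusRep

variable [DecidableEq σ]

theorem exists_hasCentralChar [IsAlgClosed K] [Module.Finite K V]
    (hT : IsTorusRep (blockParam ε) T) (h_irr : IsIrreducibleFamily T) :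
    ∃ θ, HasCentralChar ε T θ := by
  have h_scalar (p) : ∃ c : Kˣ, ∀ v, (T p ^ centralExp ε p) v = (c : K) • v := by
    obtain ⟨c, hc⟩ := h_irr.eq_smul_of_commute (f := T p ^ centralExp ε p) fun p' v => by
      rw [pow_apply_skew (hT.skew p p'), ← Units.val_pow_eq_pow_val, blockParam_pow_centralExp,
        Units.val_one, one_smul]
    have := h_irr.nontrivial
    obtain ⟨v, hv⟩ := exists_ne (0 : V)
    have hc_zero : c ≠ 0 := by
      rintro rfl
      exact hv (hT.pow_injective p _ (by rw [hc, zero_smul, map_zero]))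
    exact ⟨Units.mk0 c hc_zero, hc⟩
  choose θ hθ using h_scalar
  exact ⟨θ, hθ⟩

variable {θ : (σ × Fin 2) ⊕ τ → Kˣ} {μ : σ → Kˣ}

theorem exists_joint_eigenvector [IsAlgClosed K] [Module.Finite K V] [Nontrivial V]
    (hT : IsTorusRep (blockParam ε) T) (hθ : HasCentralChar ε T θ) (hε : ∀ i, 0 < orderOf (ε i))
    (hμ : ∀ i, μ i ^ orderOf (ε i) = θ (Sum.inl (i, 1))) (F : Finset σ) :
    ∃ v ≠ 0, ∀ j ∈ F, T (Sum.inl (j, 1)) v = (μ j : K) • v := by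
  induction F using Finset.induction_on with
  | empty => exact (exists_ne (0 : V)).imp fun v hv => ⟨hv, by simp⟩
  | insert i F hi ih =>
    obtain ⟨v, hv, hvF⟩ := ih
    let E : Submodule K V := ⨅ j ∈ F, Module.End.eigenspace (T (Sum.inl (j, 1))) (μ j : K)
    have hE (w) : w ∈ E ↔ ∀ j ∈ F, T (Sum.inl (j, 1)) w = (μ j : K) • w := by simp [E]
    obtain ⟨w, hwE, l, hw⟩ := exists_eigenvector_mem (f := T (Sum.inl (i, 1)))
      (fun w hw => (hE _).mpr fun j hj => by
        rw [hT.skew, blockParam_one_one, Units.val_one, one_smul, (hE w).mp hw j hj, map_smul])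
      ((hE v).mpr hvF) hv
    have hl : l ^ orderOf (ε i) = (μ i : K) ^ orderOf (ε i) := by
      refine smul_left_injective K hw.2 ((hw.pow_apply _).symm.trans ?_)
      exact (hθ (Sum.inl (i, 1)) w).trans (by simp [← hμ])
    -- the powers of `x i` permute the eigenvalues of `y i` transitively
    obtain ⟨a, ha⟩ := exists_pow_mul_eq_of_pow_eq (hε i) hl
    refine ⟨(T (Sum.inl (i, 0)) ^ a) w, fun h => hw.2 (hT.pow_injective _ a (h.trans (by simp))),
      fun j hj => ?_⟩
    rw [← Module.End.mem_eigenspace_iff]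
    obtain rfl | hj := Finset.mem_insert.mp hj
    · simpa [blockParam_zero_one, ha] using
        pow_apply_mem_eigenspace (hT.skew (Sum.inl (j, 0)) (Sum.inl (j, 1))) hw.apply_eq_smul a
    · simpa [blockParam_inl_of_ne (ne_of_mem_of_not_mem hj hi).symm] using
        pow_apply_mem_eigenspace (hT.skew (Sum.inl (i, 0)) (Sum.inl (j, 1))) ((hE w).mp hwE j hj) a

theorem exists_invariant_submodule (hT : IsTorusRep (blockParam ε) T) (hθ : HasCentralChar ε T θ)
    (hε : ∀ i, 0 < orderOf (ε i)) {v : V} (hv : v ≠ 0)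
    (hvμ : ∀ j, T (Sum.inl (j, 1)) v = (μ j : K) • v) (F : Finset σ) :
    ∃ W : Submodule K V, v ∈ W ∧ Module.finrank K W = ∏ i ∈ F, orderOf (ε i) ∧
      (∀ p, (∀ j ∉ F, p ≠ Sum.inl (j, 0)) → ∀ w ∈ W, T p w ∈ W) ∧
      ∀ j ∉ F, ∀ w ∈ W, T (Sum.inl (j, 1)) w = (μ j : K) • w := by
  induction F using Finset.induction_on with
  | empty =>
    have h_span {f : Module.End K V} {c : K} (hf : f v = c • v) : ∀ w ∈ K ∙ v, f w = c • w := by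
      intro w hw
      obtain ⟨a, rfl⟩ := Submodule.mem_span_singleton.mp hw
      rw [map_smul, hf, smul_comm]
    refine ⟨K ∙ v, Submodule.mem_span_singleton_self v, by simp [finrank_span_singleton hv], ?_,
      fun j _ => h_span (hvμ j)⟩
    rintro (⟨j, a⟩ | j) hp w hw
    · obtain rfl : a = 1 := Fin.eq_one_of_ne_zero a fun ha => hp j (by simp) (ha ▸ rfl)
      exact h_span (hvμ j) w hw ▸ Submodule.smul_mem _ _ hw
    · exact h_span (f := T (Sum.inr j)) (by simpa [centralExp] using hθ (Sum.inr j) v) w hw ▸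
        Submodule.smul_mem _ _ hw
  | insert i F hi ih =>
    obtain ⟨W, hvW, h_rank, hW, hWμ⟩ := ih
    have : Module.Finite K W :=
      Module.finite_of_finrank_pos (h_rank ▸ Finset.prod_pos fun j _ => hε j)
    refine ⟨iterateSpan (T (Sum.inl (i, 0))) (orderOf (ε i)) W, le_iterateSpan (hε i) hvW, ?_,
      fun p hp => ?_, fun j hj => ?_⟩
    · rw [Finset.prod_insert hi, ← h_rank]
      exact finrank_iterateSpan (blockParam_zero_one (τ := τ) (ε := ε) i ▸ hT.skew _ _)
        (hT.injective _) (hWμ i hi)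
    · by_cases hpi : p = Sum.inl (i, 0)
      · subst hpi
        exact apply_mem_iterateSpan (hε i) fun w hw =>
          hθ (Sum.inl (i, 0)) w ▸ W.smul_mem (θ (Sum.inl (i, 0)) : K) hw
      · refine apply_mem_iterateSpan_of_skew (hT.skew _ p) (hW p fun j hj => ?_)
        by_cases hji : j = i
        · exact hji ▸ hpi
        · exact hp j (by simp [hji, hj])
    · rw [Finset.mem_insert, not_or] at hj
      have h_eigenspace : iterateSpan (T (Sum.inl (i, 0))) (orderOf (ε i)) W ≤
          Module.End.eigenspace (T (Sum.inl (j, 1))) (μ j : K) :=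
        iterateSpan_le fun a _ w hw => by
          simpa [blockParam_inl_of_ne (Ne.symm hj.1)] using pow_apply_mem_eigenspace
            (hT.skew (Sum.inl (i, 0)) (Sum.inl (j, 1))) (hWμ j hj.2 w hw) a
      exact fun w hw => Module.End.mem_eigenspace_iff.mp (h_eigenspace hw)

variable [IsAlgClosed K] [Module.Finite K V]

theorem finrank_eq [Fintype σ] (hT : IsTorusRep (blockParam ε) T) (h_irr : IsIrreducibleFamily T)
    (hε : ∀ i, 0 < orderOf (ε i)) : Module.finrank K V = ∏ i, orderOf (ε i) := by
  have := h_irr.nontrivial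
  obtain ⟨θ, hθ⟩ := hT.exists_hasCentralChar h_irr
  choose μ hμ using fun i => exists_units_pow_eq (hε i) (θ (Sum.inl (i, 1)))
  obtain ⟨v, hv, hvμ⟩ := hT.exists_joint_eigenvector hθ hε hμ Finset.univ
  obtain ⟨W, hvW, h_rank, hW, -⟩ :=
    hT.exists_invariant_submodule hθ hε hv (fun j => hvμ j (Finset.mem_univ j)) Finset.univ
  rw [← h_rank, h_irr.eq_top (fun p => hW p (by simp)) hv hvW, finrank_top]

theorem exists_linearEquiv [Finite σ] [Module.Finite K V'] (hT : IsTorusRep (blockParam ε) T)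
    (h_irr : IsIrreducibleFamily T) (hT' : IsTorusRep (blockParam ε) T')
    (h_irr' : IsIrreducibleFamily T') (hε : ∀ i, 0 < orderOf (ε i)) (hθ : HasCentralChar ε T θ)
    (hθ' : HasCentralChar ε T' θ) : ∃ e : V ≃ₗ[K] V', ∀ p v, e (T p v) = T' p (e v) := by
  have := Fintype.ofFinite σ
  have := h_irr.nontrivial
  have := h_irr'.nontrivial
  choose μ hμ using fun i => exists_units_pow_eq (hε i) (θ (Sum.inl (i, 1)))
  obtain ⟨v, hv, hvμ⟩ := hT.exists_joint_eigenvector hθ hε hμ Finset.univ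
  obtain ⟨v', hv', hvμ'⟩ := hT'.exists_joint_eigenvector hθ' hε hμ Finset.univ
  obtain ⟨W, hvW, h_rank, hW, -⟩ := (hT.prodMap hT').exists_invariant_submodule (hθ.prodMap hθ') hε
    (v := (v, v')) (fun h => hv (congrArg Prod.fst h))
    (fun j => Prod.ext (hvμ j (Finset.mem_univ j)) (hvμ' j (Finset.mem_univ j))) Finset.univ
  exact h_irr.exists_linearEquiv_of_prodMap h_irr' (fun p => hW p (by simp)) hvW hv hv'
    (h_rank.trans (hT.finrank_eq h_irr hε).symm) (h_rank.trans (hT'.finrank_eq h_irr' hε).symm)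

end IsTorusRep

end Block

section RightRep

variable {K A V V' : Type*} [Field K] [Semiring A] [Algebra K A] [AddCommGroup V] [Module K V]
  [AddCommGroup V'] [Module K V']

theorem unop_apply_mem_of_adjoin_eq_top {S : Set A} (hS : Algebra.adjoin K S = ⊤)
    (ρ : A →ₐ[K] (Module.End K V)ᵐᵒᵖ) {W : Submodule K V}
    (hW : ∀ a ∈ S, ∀ w ∈ W, (ρ a).unop w ∈ W) (a : A) : ∀ w ∈ W, (ρ a).unop w ∈ W := by
  have ha : a ∈ Algebra.adjoin K S := hS ▸ Algebra.mem_top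
  induction ha using Algebra.adjoin_induction with
  | mem a ha => exact hW a ha
  | algebraMap c =>
    rw [AlgHom.commutes]
    exact fun w hw => W.smul_mem c hw
  | add a b _ _ iha ihb =>
    rw [map_add]
    exact fun w hw => W.add_mem (iha w hw) (ihb w hw)
  | mul a b _ _ iha ihb =>
    rw [map_mul]
    exact fun w hw => ihb _ (iha w hw)

theorem op_conjAlgEquiv_apply_eq_iff (e : V ≃ₗ[K] V') (f : (Module.End K V)ᵐᵒᵖ)
    (g : (Module.End K V')ᵐᵒᵖ) :
    AlgEquiv.op (e.conjAlgEquiv K) f = g ↔ ∀ v, e (f.unop v) = g.unop (e v) := by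
  refine ⟨?_, fun h => MulOpposite.unop_injective (LinearMap.ext fun w => ?_)⟩
  · rintro rfl v
    simp [LinearEquiv.conjAlgEquiv]
  · simpa [LinearEquiv.conjAlgEquiv] using h (e.symm w)

theorem mem_of_apply_mem [Module.Finite K V] {f : Module.End K V} (hf : Function.Injective f)
    {W : Submodule K V} (hW : ∀ w ∈ W, f w ∈ W) {v : V} (hv : f v ∈ W) : v ∈ W := by
  have h_surj : Function.Surjective (f.restrict hW) :=
    LinearMap.surjective_of_injective fun _ _ h => Subtype.ext (hf (congrArg Subtype.val h))
  obtain ⟨u, hu⟩ := h_surj ⟨f v, hv⟩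
  exact hf (congrArg Subtype.val hu) ▸ u.2

end RightRep

section Transport

variable {K : Type u} [Field K] {n : ℕ} {q q' : Matrix (Fin n) (Fin n) Kˣ}
  {V : Type*} [AddCommGroup V] [Module K V] {V' : Type*} [AddCommGroup V'] [Module K V']
  {T : Fin n → Module.End K V} {T' : Fin n → Module.End K V'}

/-- The action of the generators in a right representation of a quantum torus. -/
noncomputable def QTorus.genAction (ρ : QTorus q →ₐ[K] (Module.End K V)ᵐᵒᵖ) (i : Fin n) :
    Module.End K V :=
  (ρ (x q i)).unop

theorem QTorus.isTorusRep_genAction (ρ : QTorus q →ₐ[K] (Module.End K V)ᵐᵒᵖ) :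
    IsTorusRep q (genAction ρ) where
  skew i j v := by
    have h := congrArg (fun a => (ρ a).unop) (skewCommute_iff.mp (skewCommute_x q i j))
    simp only [map_smul, map_mul] at h
    exact LinearMap.congr_fun h v
  injective i := ((Module.End.isUnit_iff _).mp ((x q i).isUnit.map ρ).unop).1

theorem QTorus.unop_apply_mem_of_genAction_mem [Module.Finite K V]
    (ρ : QTorus q →ₐ[K] (Module.End K V)ᵐᵒᵖ) {W : Submodule K V}
    (hW : ∀ i, ∀ w ∈ W, genAction ρ i w ∈ W) (a : QTorus q) : ∀ w ∈ W, (ρ a).unop w ∈ W := by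
  refine unop_apply_mem_of_adjoin_eq_top (adjoin_x_eq_top (q := q)) ρ ?_ a
  rintro _ (⟨i, rfl⟩ | ⟨i, rfl⟩) w hw
  · exact hW i w hw
  · refine mem_of_apply_mem ((isTorusRep_genAction ρ).injective i) (hW i) ?_
    have h := congrArg (fun a => (ρ a).unop) (x q i).inv_mul
    simp only [map_mul, map_one] at h
    exact (LinearMap.congr_fun h w).symm ▸ hw

namespace IsTorusRep

variable [Module.Finite K V] [Module.Finite K V']

/-- The right representation of the quantum torus in which the generators act by `T`. -/
noncomputable def toAlgHom (hT : IsTorusRep q T) : QTorus q →ₐ[K] (Module.End K V)ᵐᵒᵖ :=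
  QTorus.lift
    (fun i => ((Module.End.isUnit_iff (T i)).mpr
      ⟨hT.injective i, LinearMap.surjective_of_injective (hT.injective i)⟩).op.unit)
    fun i j => skewCommute_iff.mpr (MulOpposite.unop_injective (LinearMap.ext (hT.skew i j)))

theorem unop_toAlgHom_x (hT : IsTorusRep q T) (i : Fin n) :
    (hT.toAlgHom (QTorus.x q i)).unop = T i := by
  rw [toAlgHom, QTorus.lift_x]
  rfl

/-- The action of the generators of a second quantum torus isomorphic to the first one. -/
noncomputable def transport (hT : IsTorusRep q T) (φ : QTorus q ≃ₐ[K] QTorus q') :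
    Fin n → Module.End K V :=
  QTorus.genAction (hT.toAlgHom.comp (φ.symm : QTorus q' →ₐ[K] QTorus q))

variable (φ : QTorus q ≃ₐ[K] QTorus q')

theorem isTorusRep_transport (hT : IsTorusRep q T) : IsTorusRep q' (hT.transport φ) :=
  QTorus.isTorusRep_genAction _

theorem isIrreducibleFamily_transport (hT : IsTorusRep q T) (h_irr : IsIrreducibleFamily T) :
    IsIrreducibleFamily (hT.transport φ) := by
  refine ⟨h_irr.nontrivial, fun W hW => h_irr.eq_bot_or_eq_top W fun i w hw => ?_⟩
  simpa [unop_toAlgHom_x] using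
    QTorus.unop_apply_mem_of_genAction_mem _ hW (φ (QTorus.x q i)) w hw

theorem map_apply_of_transport (hT : IsTorusRep q T) (hT' : IsTorusRep q T') {e : V ≃ₗ[K] V'}
    (he : ∀ i v, e (hT.transport φ i v) = hT'.transport φ i (e v)) (i : Fin n) (v : V) :
    e (T i v) = T' i (e v) := by
  have h_conj : ((AlgEquiv.op (e.conjAlgEquiv K) : _ →ₐ[K] (Module.End K V')ᵐᵒᵖ).comp
      (hT.toAlgHom.comp (φ.symm : QTorus q' →ₐ[K] QTorus q))) =
      hT'.toAlgHom.comp (φ.symm : QTorus q' →ₐ[K] QTorus q) :=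
    QTorus.algHom_ext fun j => (op_conjAlgEquiv_apply_eq_iff e _ _).mpr (he j)
  have h := (op_conjAlgEquiv_apply_eq_iff e _ _).mp (DFunLike.congr_fun h_conj (φ (QTorus.x q i))) v
  simpa [unop_toAlgHom_x] using h

end IsTorusRep

end Transport

section AffineModules

variable {K : Type u} [Field K] {n : ℕ} {q : Matrix (Fin n) (Fin n) Kˣ}

theorem val_pow_card_paramGroup (i j : Fin n) : (q i j : K) ^ Nat.card (paramGroup q) = 1 := by
  have h := pow_card_eq_one' (x := (⟨q i j, mem_paramGroup i j⟩ : paramGroup q))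
  exact congrArg (fun a : paramGroup q => ((a : Kˣ) : K)) h

namespace SimpleMod

/-- The vector space structure on a module over quantum affine space, through the structure map of
the algebra; it is the one with respect to which `SimpleMod.dim` is the dimension. -/
@[reducible]
def moduleBase (M : SimpleMod q) : Module K M.carrier :=
  Module.compHom M.carrier (algebraMap K (QAffine q)ᵐᵒᵖ)

attribute [local instance] moduleBase

instance isScalarTower (M : SimpleMod q) : IsScalarTower K (QAffine q)ᵐᵒᵖ M.carrier :=
  IsScalarTower.of_algebraMap_smul fun _ _ => rfl

/-- A right module over quantum affine space as a right representation. -/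
noncomputable def rightRep (M : SimpleMod q) : QAffine q →ₐ[K] (Module.End K M.carrier)ᵐᵒᵖ :=
  AlgHom.opComm.symm (Algebra.lsmul K K M.carrier)

/-- The action of the generators on a module over quantum affine space. -/
noncomputable def genAction (M : SimpleMod q) (i : Fin n) : Module.End K M.carrier :=
  (M.rightRep (QAffine.x q i)).unop

theorem genAction_skew (M : SimpleMod q) (i j : Fin n) (v : M.carrier) :
    M.genAction j (M.genAction i v) = (q i j : K) • M.genAction i (M.genAction j v) := by
  have h := congrArg (fun a => (M.rightRep a).unop) (QAffine.x_mul_x (q := q) i j)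
  simp only [map_smul, map_mul] at h
  exact LinearMap.congr_fun h v

theorem isIrreducibleFamily (M : SimpleMod q) : IsIrreducibleFamily M.genAction := by
  have := M.simple
  refine ⟨IsSimpleModule.nontrivial (QAffine q)ᵐᵒᵖ M.carrier, fun W hW => ?_⟩
  let N : Submodule (QAffine q)ᵐᵒᵖ M.carrier :=
    { W with
      smul_mem' := fun a w hw => unop_apply_mem_of_adjoin_eq_top QAffine.adjoin_x_eq_top M.rightRep
        (Set.forall_mem_range.mpr hW) a.unop w hw }
  have hN : N.restrictScalars K = W := rfl
  refine (eq_bot_or_eq_top N).imp (fun h => ?_) fun h => ?_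
  · rw [← hN, h, Submodule.restrictScalars_bot]
  · rw [← hN, h, Submodule.restrictScalars_top]

theorem isTorusRep (M : SimpleMod q) : IsTorusRep q M.genAction where
  skew := M.genAction_skew
  injective i := by
    obtain ⟨v, hv⟩ := M.nontrivial i
    rw [← LinearMap.ker_eq_bot]
    refine (M.isIrreducibleFamily.eq_bot_or_eq_top _ fun j w hw => ?_).resolve_right fun h =>
      hv (LinearMap.mem_ker.mp (h ▸ Submodule.mem_top : v ∈ LinearMap.ker (M.genAction i)))
    rw [LinearMap.mem_ker] at hw ⊢
    rw [M.genAction_skew, hw, map_zero, smul_zero]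

theorem module_finite [Finite (paramGroup q)] (M : SimpleMod q) : Module.Finite K M.carrier :=
  M.isIrreducibleFamily.module_finite (fun i j => M.genAction_skew j i) Nat.card_pos
    fun i j => val_pow_card_paramGroup j i

theorem equiv_of_genAction {M N : SimpleMod q} (e : M.carrier ≃ₗ[K] N.carrier)
    (he : ∀ i v, e (M.genAction i v) = N.genAction i (e v)) : M ≈ N := by
  have h_conj : (AlgEquiv.op (e.conjAlgEquiv K) : _ →ₐ[K] _).comp M.rightRep = N.rightRep :=
    AlgHom.ext_of_adjoin_eq_top QAffine.adjoin_x_eq_top (Set.forall_mem_range.mpr fun i =>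
      (op_conjAlgEquiv_apply_eq_iff e _ _).mpr (he i))
  exact ⟨{ e with
    map_smul' := fun a => (op_conjAlgEquiv_apply_eq_iff e (M.rightRep a.unop) _).mp
      (DFunLike.congr_fun h_conj a.unop) }⟩

end SimpleMod

end AffineModules

section Classification

variable {K : Type u} [Field K] {n : ℕ} {q : Matrix (Fin n) (Fin n) Kˣ} {σ τ : Type*}
  [DecidableEq σ] {ε : σ → Kˣ} {e : Fin n ≃ (σ × Fin 2) ⊕ τ}

/-- The parameters of a block torus, indexed by `Fin n`. -/
def blockMatrix (ε : σ → Kˣ) (e : Fin n ≃ (σ × Fin 2) ⊕ τ) : Matrix (Fin n) (Fin n) Kˣ :=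
  fun a b => blockParam ε (e a) (e b)

theorem IsTorusRep.comp_symm {V : Type*} [AddCommGroup V] [Module K V] {T : Fin n → Module.End K V}
    (hT : IsTorusRep (blockMatrix ε e) T) : IsTorusRep (blockParam ε) fun p => T (e.symm p) :=
  ⟨fun p p' v => by simpa [blockMatrix] using hT.skew (e.symm p) (e.symm p') v,
    fun p => hT.injective _⟩

attribute [local instance] SimpleMod.moduleBase

variable [Finite (paramGroup q)]

namespace SimpleMod

variable (φ : QTorus q ≃ₐ[K] QTorus (blockMatrix ε e))

/-- The action of the generators of an isomorphic block torus on a simple module over quantum affine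
space on which no variable acts as zero. -/
noncomputable def blockAction (M : SimpleMod q) (p : (σ × Fin 2) ⊕ τ) :
    Module.End K M.carrier :=
  have := M.module_finite
  M.isTorusRep.transport φ (e.symm p)

theorem isTorusRep_blockAction (M : SimpleMod q) :
    IsTorusRep (blockParam ε) (M.blockAction φ) :=
  have := M.module_finite
  (M.isTorusRep.isTorusRep_transport φ).comp_symm

theorem isIrreducibleFamily_blockAction (M : SimpleMod q) :
    IsIrreducibleFamily (M.blockAction φ) :=
  have := M.module_finite
  (M.isTorusRep.isIrreducibleFamily_transport φ M.isIrreducibleFamily).comp_equiv e.symm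

theorem equiv_of_blockAction {M N : SimpleMod q} (l : M.carrier ≃ₗ[K] N.carrier)
    (hl : ∀ p v, l (M.blockAction φ p v) = N.blockAction φ p (l v)) : M ≈ N :=
  have := M.module_finite
  have := N.module_finite
  equiv_of_genAction l (M.isTorusRep.map_apply_of_transport φ N.isTorusRep fun i v => by
    simpa [blockAction] using hl (e i) v)

end SimpleMod

variable [IsAlgClosed K]

theorem SimpleMod.dim_eq_prod [Fintype σ] (φ : QTorus q ≃ₐ[K] QTorus (blockMatrix ε e))
    (hε : ∀ i, 0 < orderOf (ε i)) (M : SimpleMod q) :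
    M.dim = (∏ i, orderOf (ε i) : ℕ) := by
  have := M.module_finite
  rw [← (M.isTorusRep_blockAction φ).finrank_eq (M.isIrreducibleFamily_blockAction φ) hε,
    Module.finrank_eq_rank]
  rfl

theorem exists_injective_simpleClass [Finite σ] (φ : QTorus q ≃ₐ[K] QTorus (blockMatrix ε e))
    (hε : ∀ i, 0 < orderOf (ε i)) :
    ∃ f : SimpleClass q → Fin n → Kˣ, Function.Injective f := by
  have h_char (M : SimpleMod q) : ∃ θ, HasCentralChar ε (M.blockAction φ) θ :=
    have := M.module_finite
    (M.isTorusRep_blockAction φ).exists_hasCentralChar (M.isIrreducibleFamily_blockAction φ)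
  choose θ hθ using h_char
  refine ⟨fun c a => θ c.out (e a), fun c c' h_eq => ?_⟩
  have hθ_eq : θ c.out = θ c'.out := funext fun p => by simpa using congrFun h_eq (e.symm p)
  have := c.out.module_finite
  have := c'.out.module_finite
  obtain ⟨l, hl⟩ := (c.out.isTorusRep_blockAction φ).exists_linearEquiv
    (c.out.isIrreducibleFamily_blockAction φ) (c'.out.isTorusRep_blockAction φ)
    (c'.out.isIrreducibleFamily_blockAction φ) hε (hθ c.out) (hθ_eq ▸ hθ c'.out)
  rw [← c.out_eq, ← c'.out_eq]
  exact Quotient.sound (SimpleMod.equiv_of_blockAction φ l hl)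

end Classification

section Existence

theorem nonempty_simpleMod_of_isTorusRep {K : Type u} [Field K] {n : ℕ}
    {q : Matrix (Fin n) (Fin n) Kˣ} {V : Type u} [AddCommGroup V] [Module K V] [Module.Finite K V]
    [Nontrivial V] {T : Fin n → Module.End K V} (hT : IsTorusRep q T) : Nonempty (SimpleMod q) := by
  let ρ : (QAffine q)ᵐᵒᵖ →ₐ[K] Module.End K V :=
    AlgHom.opComm (QAffine.lift (fun i => MulOpposite.op (T i)) fun i j =>
      MulOpposite.unop_injective (LinearMap.ext (hT.skew i j)))
  let _ : Module (QAffine q)ᵐᵒᵖ V := Module.compHom V (ρ : (QAffine q)ᵐᵒᵖ →+* Module.End K V)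
  have : IsScalarTower K (QAffine q)ᵐᵒᵖ V := ⟨fun c a v => LinearMap.congr_fun (map_smul ρ c a) v⟩
  have h_smul (i) (v : V) : MulOpposite.op (QAffine.x q i) • v = T i v :=
    congrArg (fun f : (Module.End K V)ᵐᵒᵖ => f.unop v) (QAffine.lift_x _ _ i)
  have : IsArtinian (QAffine q)ᵐᵒᵖ V := isArtinian_of_tower K inferInstance
  obtain ⟨N, hN⟩ := IsAtomic.exists_atom (Submodule (QAffine q)ᵐᵒᵖ V)
  have h_simple := isSimpleModule_iff_isAtom.mpr hN
  obtain ⟨v, hvN, hv⟩ := (Submodule.ne_bot_iff N).mp hN.1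
  refine ⟨⟨N, h_simple, fun i => ⟨⟨v, hvN⟩, fun h => hv (hT.injective i ?_)⟩⟩⟩
  rw [map_zero, ← h_smul]
  exact congrArg Subtype.val h

section Shift

variable {K : Type*} [Field K] {n : ℕ} {q : Matrix (Fin n) (Fin n) Kˣ} {m : ℕ} [NeZero m]
  (hm : ∀ i j, (q i j : K) ^ m = 1)

/-- The weights of the shift operators, chosen such that the shift in the coordinate `j` multiplies
the weight of index `i` by `q i j` if `j < i` and does not change it otherwise. -/
noncomputable def shiftWeight (i : Fin n) (a : Fin n → ZMod m) : K :=
  ∏ k, if k < i then AddChar.zmodChar m (hm i k) (a k) else 1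

theorem shiftWeight_ne_zero (i : Fin n) (a : Fin n → ZMod m) : shiftWeight hm i a ≠ 0 := by
  refine Finset.prod_ne_zero_iff.mpr fun k _ => ?_
  split_ifs
  · rw [AddChar.zmodChar_apply]
    exact pow_ne_zero _ (q i k).ne_zero
  · exact one_ne_zero

theorem shiftWeight_add_single (i j : Fin n) (a : Fin n → ZMod m) :
    shiftWeight hm i (a + Pi.single j 1) =
      shiftWeight hm i a * if j < i then (q i j : K) else 1 := by
  have h_factor (k) : (if k < i then
        AddChar.zmodChar m (hm i k) (a k + (Pi.single j 1 : Fin n → ZMod m) k) else 1) =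
      (if k < i then AddChar.zmodChar m (hm i k) (a k) else 1) *
        if k = j then (if j < i then (q i j : K) else 1) else 1 := by
    by_cases hkj : k = j
    · subst hkj
      have h_one : AddChar.zmodChar m (hm i k) 1 = q i k := by
        simpa using AddChar.zmodChar_apply' (hm i k) 1
      by_cases hki : k < i <;> simp [hki, AddChar.map_add_eq_mul, h_one]
    · simp [hkj]
  simp only [shiftWeight, Pi.add_apply, h_factor, Finset.prod_mul_distrib, Finset.prod_ite_eq',
    Finset.mem_univ, if_true]

/-- The weighted shift operators on the functions on `(ℤ/m)ⁿ`. -/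
noncomputable def shiftOp (i : Fin n) : Module.End K ((Fin n → ZMod m) → K) where
  toFun f a := shiftWeight hm i a * f (a + Pi.single i 1)
  map_add' f g := by funext a; simp [mul_add]
  map_smul' c f := by funext a; simp [mul_left_comm]

theorem shiftOp_injective (i : Fin n) : Function.Injective (shiftOp hm i) := by
  intro f g h
  funext a
  have h_at := congrFun h (a - Pi.single i 1)
  simpa [shiftOp, shiftWeight_ne_zero] using h_at

theorem isTorusRep_shiftOp (hq : IsMulAntisymm q) : IsTorusRep q (shiftOp hm) where
  skew i j f := by
    funext a
    simp only [Pi.smul_apply, smul_eq_mul, shiftOp, LinearMap.coe_mk, AddHom.coe_mk,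
      shiftWeight_add_single]
    rw [add_right_comm a (Pi.single i 1)]
    obtain h | rfl | h := lt_trichotomy i j
    · have h_inv : (q i j : K) * (q j i : K) = 1 := by
        rw [hq.2 i j, Units.mul_inv]
      rw [if_neg h.not_gt, if_pos h]
      linear_combination (-(shiftWeight hm i a * shiftWeight hm j a *
        f (a + Pi.single j 1 + Pi.single i 1))) * h_inv
    · simp [hq.1]
    · rw [if_neg h.not_gt, if_pos h]
      ring
  injective := shiftOp_injective hm

end Shift

theorem nonempty_simpleMod {K : Type u} [Field K] {n : ℕ} {q : Matrix (Fin n) (Fin n) Kˣ}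
    [Finite (paramGroup q)] (hq : IsMulAntisymm q) : Nonempty (SimpleMod q) :=
  have : NeZero (Nat.card (paramGroup q)) := ⟨Nat.card_pos.ne'⟩
  nonempty_simpleMod_of_isTorusRep (isTorusRep_shiftOp val_pow_card_paramGroup hq)

end Existence

theorem IsNormalForm.exists_algEquiv_blockMatrix {K : Type u} [Field K] {n : ℕ}
    {q : Matrix (Fin n) (Fin n) Kˣ} {g : Kˣ} {s : ℕ} {h : Fin s → ℕ} {z : ℕ}
    (H : IsNormalForm q g s h z) :
    ∃ e : Fin n ≃ (Fin s × Fin 2) ⊕ Fin (n - 2 * s),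
      Nonempty (QTorus q ≃ₐ[K] QTorus (blockMatrix (fun i => g ^ normalExp n h z i) e)) := by
  have h_le := H.two_mul_le
  let e : Fin n ≃ (Fin s × Fin 2) ⊕ Fin (n - 2 * s) := Fintype.equivOfCardEq (by
    simp only [Fintype.card_fin, Fintype.card_sum, Fintype.card_prod]
    omega)
  exact ⟨e, ⟨H.iso.some.trans (nonempty_algEquiv_blockTorus e fun _ _ => rfl).some.symm⟩⟩

theorem IsNormalForm.orderOf_pow_normalExp {K : Type u} [Field K] {n : ℕ}
    {q : Matrix (Fin n) (Fin n) Kˣ} [Finite (paramGroup q)] {g : Kˣ}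
    (hg : Subgroup.zpowers g = paramGroup q) {s : ℕ} {h : Fin s → ℕ} {z : ℕ}
    (H : IsNormalForm q g s h z) (i : Fin s) :
    orderOf (g ^ normalExp n h z i) = Nat.card (paramGroup q) / h i := by
  have h_dvd := H.dvd_card i
  have h_ne : h i ≠ 0 := fun h_zero => Nat.card_pos.ne' (zero_dvd_iff.mp (h_zero ▸ h_dvd))
  rw [← hg, Nat.card_zpowers] at h_dvd ⊢
  rw [H.order_eq, orderOf_pow_of_dvd h_ne h_dvd]

theorem IsNormalForm.orderOf_pow_normalExp_pos {K : Type u} [Field K] {n : ℕ}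
    {q : Matrix (Fin n) (Fin n) Kˣ} [Finite (paramGroup q)] {g : Kˣ}
    (hg : Subgroup.zpowers g = paramGroup q) {s : ℕ} {h : Fin s → ℕ} {z : ℕ}
    (H : IsNormalForm q g s h z) (i : Fin s) : 0 < orderOf (g ^ normalExp n h z i) := by
  rw [H.orderOf_pow_normalExp hg]
  exact Nat.div_pos_iff.mpr ⟨Nat.pos_of_dvd_of_pos (H.dvd_card i) Nat.card_pos, (H.lt_card i).le⟩

end QuantumSpace

theorem mainTheorem3 {K : Type u} [Field K] [IsAlgClosed K] {n : ℕ}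
    (q : Matrix (Fin n) (Fin n) Kˣ) (hq : QuantumSpace.IsMulAntisymm q)
    (htors : IsMulTorsion (QuantumSpace.paramGroup q)) :
    (∃ g : Kˣ, Subgroup.zpowers g = QuantumSpace.paramGroup q) ∧
    (∀ g : Kˣ, Subgroup.zpowers g = QuantumSpace.paramGroup q →
      ∃ (s : ℕ) (h : Fin s → ℕ) (z : ℕ), QuantumSpace.IsNormalForm q g s h z) ∧
    ∃ Ψ : (Fin n → Kˣ) → QuantumSpace.SimpleClass q,
      Function.Surjective Ψ ∧
      ∀ g : Kˣ, Subgroup.zpowers g = QuantumSpace.paramGroup q →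
        ∀ (s : ℕ) (h : Fin s → ℕ) (z : ℕ), QuantumSpace.IsNormalForm q g s h z →
          ∀ α : Fin n → Kˣ, QuantumSpace.SimpleClass.dim (Ψ α) =
            ((∏ i : Fin s, Nat.card (QuantumSpace.paramGroup q) / h i : ℕ) : Cardinal.{u}) := by
  have := QuantumSpace.paramGroup_finite htors
  obtain ⟨g, hg⟩ := QuantumSpace.exists_zpowers_eq_paramGroup (q := q)
  refine ⟨⟨g, hg⟩, fun g hg => QuantumSpace.exists_isNormalForm hq hg, ?_⟩
  obtain ⟨s, h, z, H⟩ := QuantumSpace.exists_isNormalForm hq hg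
  obtain ⟨e, ⟨φ⟩⟩ := H.exists_algEquiv_blockMatrix
  obtain ⟨f, hf⟩ := QuantumSpace.exists_injective_simpleClass φ (H.orderOf_pow_normalExp_pos hg)
  have : Nonempty (QuantumSpace.SimpleClass q) :=
    (QuantumSpace.nonempty_simpleMod hq).map (Quotient.mk _)
  refine ⟨Function.invFun f, Function.invFun_surjective hf, fun g hg s h z H α => ?_⟩
  obtain ⟨e, ⟨φ⟩⟩ := H.exists_algEquiv_blockMatrix
  obtain ⟨M, hM⟩ := Quotient.exists_rep (Function.invFun f α)
  calc QuantumSpace.SimpleClass.dim (Function.invFun f α) = M.dim := by rw [← hM]; rfl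
    _ = (∏ i, orderOf (g ^ QuantumSpace.normalExp n h z i) : ℕ) :=
      M.dim_eq_prod φ (H.orderOf_pow_normalExp_pos hg)
    _ = (∏ i, Nat.card (QuantumSpace.paramGroup q) / h i : ℕ) := by
      simp only [H.orderOf_pow_normalExp hg]
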